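/- Let $\beta,n\ge 1$ be integers. For an open set $U\subseteq\mathbb R$ and $f\in L^2(U)$ with weak derivative $f^{(\beta)}\in L^2(U)$ put $\|f\|_{S^\beta(U)}^2=\|f\|_{L^2(U)}^2+\|f^{(\beta)}\|_{L^2(U)}^2$, let $S^\beta(R)$ be the set of all $f$ on $[0,1]$ with $\|f\|_{S^\beta((0,1))}\le R$, and let $$\Gamma_\beta=\inf\{\|K\|_{S^\beta(\mathbb R)}:\ \|K\|_{L^2(\mathbb R)}=1,\ \operatorname{supp}K\subseteq[-1/2,1/2]\}.$$ In the Gaussian white noise model with parameter $f\in S^\beta(R)$ one observes the path $$Y_x=\int_0^x f(t)\,dt+n^{-1/2}W_x,\qquad x\in[0,1],$$ where $W$ is a standard Brownian motion. An estimator $\widehat f$ is a jointly measurable real-valued function of $x\in[0,1]$ and the data; it may also depend on a randomization variable that is independent of $Y$ and has a known distribution. Write $E_f$ and $\operatorname{Var}_f$ for expectation and variance under $f$, with variance $+\infty$ for variables that are not square integrable, and $$\operatorname{IBias}_f^2(\widehat f)=\int_0^1\big(E_f[\widehat f(x)]-f(x)\big)^2dx,\qquad \operatorname{IVar}_f(\widehat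 f)=\int_0^1\operatorname{Var}_f(\widehat f(x))\,dx,$$ $$\operatorname{MISE}_f(\widehat f)=E_f\Big[\int_0^1(\widehat f(x)-f(x))^2dx\Big],$$ with $|\operatorname{IBias}_f|=(\operatorname{IBias}_f^2)^{1/2}$. Let $T$ be the set of all estimators $\widehat f$ such that, for every $f\in S^\beta(R)$, $E_f[\widehat f(x)]$ exists and is finite for almost every $x\in[0,1]$, and $\sup_{f\in S^\beta(R)}\operatorname{IBias}_f^2(\widehat f)<2^{-\beta}$. Assume $R>2\Gamma_\beta$. Then, with the convention $0\cdot(+\infty)=+\infty$, $$\inf_{\widehat f\in T}\ \Big(\sup_{f\in S^\beta(R)}\big|\operatorname{IBias}_f(\widehat f)\big|^{1/\beta}\Big)\Big(\sup_{f\in S^\beta(R)}\operatorname{IVar}_f(\widehat f)\Big)\ \ge\ \frac1{8n}.$$ Moreover, with the infimum over all estimators (without bias or integrability restriction), $$\inf_{\widehat f}\ \sup_{f\in S^\beta(R)}\operatorname{MISE}_f(\widehat f)\ \ge\ \Big(\frac1{8n}\Big)^{2\beta/(2\beta+1)}\wedge 1 .$$ -/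

import Mathlib

open MeasureTheory ProbabilityTheory Set
open scoped ENNReal NNReal ContDiff

namespace WhiteNoise

noncomputable section

/-! ### Sobolev spaces of integer order on an open subset of the line -/

/-- `g` is the weak derivative of order `k` of `f` on the open set `U`. -/
def IsWeakDeriv (U : Set ℝ) (k : ℕ) (f g : ℝ → ℝ) : Prop :=
  LocallyIntegrableOn f U ∧ LocallyIntegrableOn g U ∧
    ∀ φ : ℝ → ℝ, ContDiff ℝ ∞ φ → HasCompactSupport φ → tsupport φ ⊆ U →
      ∫ x in U, f x * iteratedDeriv k φ x = (-1) ^ k * ∫ x in U, g x * φ x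

/-- The Sobolev norm `(‖f‖² + ‖f⁽ᵏ⁾‖²)^{1/2}` with `L²(U)`-norms on the right. The weak derivative
is unique almost everywhere on `U`, so the infimum is over a single value; it is `∞` if there is
no weak derivative of order `k`. -/
def sobolevNorm (U : Set ℝ) (k : ℕ) (f : ℝ → ℝ) : ℝ≥0∞ :=
  ⨅ (g : ℝ → ℝ) (_ : IsWeakDeriv U k f g),
    (eLpNorm f 2 (volume.restrict U) ^ 2 + eLpNorm g 2 (volume.restrict U) ^ 2) ^ (1 / 2 : ℝ)

/-- The ball of radius `R` in the Sobolev space of order `k` on the unit interval. Only the values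
of `f` on the unit interval matter. -/
def sobolevBall (k : ℕ) (R : ℝ) : Set (ℝ → ℝ) :=
  {f | sobolevNorm (Ioo 0 1) k f ≤ ENNReal.ofReal R}

/-- The infimum of the Sobolev norm on the whole line over all functions with unit `L²`-norm and
support in `[-1/2, 1/2]`. -/
def Gam (k : ℕ) : ℝ≥0∞ :=
  ⨅ (K : ℝ → ℝ) (_ : eLpNorm K 2 volume = 1)
    (_ : Function.support K ⊆ Icc (-(1 / 2) : ℝ) (1 / 2)), sobolevNorm univ k K

/-! ### The Gaussian white noise model -/

/-- The observed path `Y_x = ∫₀ˣ f(t) dt + n^{-1/2} W_x`, `x ∈ [0,1]`. -/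
def path {Ω : Type*} (n : ℕ) (W : ℝ≥0 → Ω → ℝ) (f : ℝ → ℝ) (w : Ω) : unitInterval → ℝ :=
  fun x => (∫ t in (0 : ℝ)..(x : ℝ), f t) + (n : ℝ) ^ (-(1 / 2) : ℝ) * W ⟨(x : ℝ), x.2.1⟩ w

/-- The joint law of the observed path and of an independent randomization variable with
distribution `ν`, if the regression function is `f`. -/
def law {Ω Z : Type*} [MeasurableSpace Ω] [MeasurableSpace Z] (n : ℕ) (W : ℝ≥0 → Ω → ℝ)
    (P : Measure Ω) (ν : Measure Z) (f : ℝ → ℝ) : Measure ((unitInterval → ℝ) × Z) :=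
  (P.map (path n W f)).prod ν

/-! ### Risk measures

Here `E` is the space of the data, `Q` the law of the data under the regression function `f`, and
`fhat y x` is the value at `x` of the estimate computed from the data `y`. -/

section Risk

variable {E : Type*} [MeasurableSpace E]

/-- Integrated squared bias. -/
def iBiasSq (Q : Measure E) (fhat : E → ℝ → ℝ) (f : ℝ → ℝ) : ℝ≥0∞ :=
  ∫⁻ x in Icc (0 : ℝ) 1, ‖(∫ y, fhat y x ∂Q) - f x‖ₑ ^ 2

/-- The (nonnegative) square root of the integrated squared bias. -/
def iBias (Q : Measure E) (fhat : E → ℝ → ℝ) (f : ℝ → ℝ) : ℝ≥0∞ :=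
  iBiasSq Q fhat f ^ (1 / 2 : ℝ)

/-- Integrated variance; the pointwise variance is `∞` where `fhat · x` is not square
integrable. -/
def iVar (Q : Measure E) (fhat : E → ℝ → ℝ) : ℝ≥0∞ :=
  ∫⁻ x in Icc (0 : ℝ) 1, evariance (fun y => fhat y x) Q

/-- Mean integrated squared error. -/
def mise (Q : Measure E) (fhat : E → ℝ → ℝ) (f : ℝ → ℝ) : ℝ≥0∞ :=
  ∫⁻ y, (∫⁻ x in Icc (0 : ℝ) 1, ‖fhat y x - f x‖ₑ ^ 2) ∂Q

/-- `fhat` is a (jointly measurable) estimator whose pointwise expectation exists and is finite,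
at almost every point of the unit interval, for every parameter `f ∈ Θ`; here `Q f` is the law of
the data under `f`. -/
def HasBias (Θ : Set (ℝ → ℝ)) (Q : (ℝ → ℝ) → Measure E) (fhat : E → ℝ → ℝ) : Prop :=
  Measurable (Function.uncurry fhat) ∧
    ∀ f ∈ Θ, ∀ᵐ x ∂(volume.restrict (Icc (0 : ℝ) 1)), Integrable (fun y => fhat y x) (Q f)

/-- The class of estimators with worst-case integrated squared bias less than `2^{-k}`. -/
def smallBias (k : ℕ) (Θ : Set (ℝ → ℝ)) (Q : (ℝ → ℝ) → Measure E) : Set (E → ℝ → ℝ) :=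
  {fhat | HasBias Θ Q fhat ∧ (⨆ f ∈ Θ, iBiasSq (Q f) fhat f) < (2 : ℝ≥0∞)⁻¹ ^ k}

end Risk

open Classical in
/-- Multiplication on `[0, ∞]` with the convention `0 · ∞ = ∞ · 0 = ∞`. -/
def mulTop (a b : ℝ≥0∞) : ℝ≥0∞ := if a = ⊤ ∨ b = ⊤ then ⊤ else a * b

end

end WhiteNoise

/-! The bound comes from a finite-dimensional subproblem. For each m, the ball contains an
m-dimensional family f_θ = ∑ θ_k φ_k, with orthonormal φ_k obtained as disjoint rescaled copies of a
nearly optimal kernel; every θ with |θ|² ≤ 4 m^{-2β} is admissible, which is where R > 2Γ is used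
(`exists_orthonormal_system`). Along this family the observed path is a fixed measurable function of
a vector y ~ N(θ, I/n) and of independent noise with known law (`exists_law_eq_map`). So any
estimator becomes a randomized estimator in a Gaussian sequence model with variance v = 1/n.

The heart is `card_mul_le_of_iVar_le`, an averaged information inequality. Let π be a smooth radial
weight on θ-space, equal to 1 for |θ|² ≤ 4B and to 0 for |θ|² ≥ b, and write ∇π(θ) = -w(θ) θ with w
≥ 0. The score of the Gaussian density p_θ(y) is (y - θ)/v, so integrating by parts in θ, for fixed
data, gives ∫ π(θ) E_θ⟨f̂, f_{y-θ}⟩ dθ = v ∫ w(θ) E_θ⟨f̂, f_θ⟩ dθ. On the left f_{y-θ} has mean zero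
and E_θ‖f_{y-θ}‖² = mv, so only the centred part of f̂ counts and the pairing is at most V + mv/4 if
the integrated variance is at most V. On the right w lives on the shell 4B ≤ |θ|² ≤ b, where a
squared bias of at most B forces E_θ⟨f̂, f_θ⟩ ≥ |θ|²/2. A further integration by parts gives ∫ w
|θ|² = m ∫ π. Hence mv/2 ≤ V + mv/4, that is, V ≥ mv/4.

With b = 4 m^{-2β} the requirement 4B < b reads B m^{2β} < 1. The largest such m is at least
B^{-1/(2β)}/2 when 0 < B < 1, so B^{1/(2β)} V ≥ 1/(8n). For the MISE, the maximal risk M dominates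
both squared bias and variance; if M < 1 the same inequality yields M^{1+1/(2β)} ≥ 1/(8n). -/

namespace WhiteNoise

/-! ### The Wiener integral of a Brownian motion on the unit interval -/

section WienerIntegral

/-- Lebesgue measure on the unit interval. -/
noncomputable abbrev unitVol : Measure ℝ := volume.restrict (Icc (0 : ℝ) 1)

instance : IsProbabilityMeasure unitVol := ⟨by simp [unitVol]⟩

/-- The indicator function of `[0, t]` as an element of `L²([0,1])`. -/
noncomputable def indIic (t : unitInterval) : Lp ℝ 2 unitVol :=
  indicatorConstLp 2 (measurableSet_Iic (a := (t : ℝ))) (measure_ne_top _ _) 1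

theorem inner_indIic_left (t : unitInterval) (h : Lp ℝ 2 unitVol) :
    inner ℝ (indIic t) h = ∫ x in (0 : ℝ)..t, h x := by
  rw [indIic, L2.inner_indicatorConstLp_one, Measure.restrict_restrict measurableSet_Iic,
    intervalIntegral.integral_of_le t.2.1, ← integral_Icc_eq_integral_Ioc]
  congr 2
  ext x
  simp only [mem_inter_iff, mem_Iic, mem_Icc]
  exact ⟨fun ⟨h1, h2, _⟩ ↦ ⟨h2, h1⟩, fun ⟨h1, h2⟩ ↦ ⟨h2, h1, h2.trans t.2.2⟩⟩

theorem inner_indIic_indIic (s t : unitInterval) :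
    inner ℝ (indIic s) (indIic t) = min (s : ℝ) t := by
  rw [indIic, indIic, L2.real_inner_indicatorConstLp_one_indicatorConstLp_one,
    measureReal_restrict_apply (measurableSet_Iic.inter measurableSet_Iic), Iic_inter_Iic]
  have : Iic ((s : ℝ) ⊓ t) ∩ Icc (0 : ℝ) 1 = Icc 0 (min (s : ℝ) t) := by
    ext x
    simp only [mem_inter_iff, mem_Iic, mem_Icc]
    exact ⟨fun ⟨h1, h2, _⟩ ↦ ⟨h2, h1⟩,
      fun ⟨h1, h2⟩ ↦ ⟨h2, h1, h2.trans ((min_le_left _ _).trans s.2.2)⟩⟩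
  rw [this]
  simp [s.2.1, t.2.1]

/-- An orthogonal function has vanishing indefinite integral, hence vanishes almost everywhere by
Lebesgue differentiation. This density makes the Wiener integral defined on all of L². -/
theorem span_indIic_orthogonal : (Submodule.span ℝ (range indIic))ᗮ = ⊥ := by
  rw [Submodule.eq_bot_iff]
  intro h hh
  have h0 (t : unitInterval) : ∫ x in (0 : ℝ)..t, h x = 0 := by
    rw [← inner_indIic_left]
    exact (Submodule.mem_orthogonal _ _).1 hh _ (Submodule.subset_span ⟨t, rfl⟩)
  have hi : IntervalIntegrable h volume 0 1 := by
    rw [intervalIntegrable_iff_integrableOn_Icc_of_le zero_le_one]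
    exact (Lp.memLp h).integrable (by norm_num)
  rw [Lp.eq_zero_iff_ae_eq_zero]
  change ∀ᵐ x ∂(volume.restrict (Icc (0 : ℝ) 1)), h x = 0
  rw [← restrict_Ioo_eq_restrict_Icc, ae_restrict_iff' measurableSet_Ioo]
  filter_upwards [hi.ae_hasDerivAt_integral] with x hx hxI
  have hd := hx (by rw [uIcc_of_le zero_le_one]; exact Ioo_subset_Icc_self hxI) 0 (by simp)
  have h1 : HasDerivAt (fun y ↦ ∫ t in (0 : ℝ)..y, h t) 0 x := by
    refine (hasDerivAt_const x (0 : ℝ)).congr_of_eventuallyEq ?_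
    filter_upwards [Ioo_mem_nhds hxI.1 hxI.2] with y hy
    exact h0 ⟨y, hy.1.le, hy.2.le⟩
  exact hd.unique h1

variable {Ω : Type*} [MeasurableSpace Ω] {P : Measure Ω} {W : ℝ≥0 → Ω → ℝ}

/-- The time `t` of the unit interval as a nonnegative real. -/
def toNN (t : unitInterval) : ℝ≥0 := ⟨t, t.2.1⟩

theorem memLp_eval (hW : IsPreBrownianReal W P) (t : ℝ≥0) : MemLp (W t) 2 P :=
  (hW.isGaussianProcess.hasGaussianLaw_eval t).memLp_two

/-- The value at time `t` of a Brownian motion, as a square integrable random variable. -/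
noncomputable def evalLp (hW : IsPreBrownianReal W P) (t : unitInterval) : Lp ℝ 2 P :=
  (memLp_eval hW (toNN t)).toLp

theorem inner_evalLp_evalLp (hW : IsPreBrownianReal W P) (s t : unitInterval) :
    inner ℝ (evalLp hW s) (evalLp hW t) = min (s : ℝ) t := by
  have := hW.isGaussianProcess.isProbabilityMeasure
  have h1 := hW.covariance_eval (toNN s) (toNN t)
  rw [covariance_eq_sub (memLp_eval hW _) (memLp_eval hW _), hW.integral_eval] at h1
  simp only [zero_mul, sub_zero, Pi.mul_apply] at h1
  rw [L2.inner_def]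
  have h2 : ∫ w, inner ℝ (evalLp hW s w) (evalLp hW t w) ∂P
      = ∫ w, W (toNN s) w * W (toNN t) w ∂P := by
    refine integral_congr_ae ?_
    filter_upwards [(memLp_eval hW (toNN s)).coeFn_toLp, (memLp_eval hW (toNN t)).coeFn_toLp]
      with w h1 h2
    simp [evalLp, h1, h2, mul_comm]
  rw [h2, h1]
  exact NNReal.coe_min _ _

/-- The closed linear span of the pairs (indicator of `[0, t]`, value of Brownian motion at `t`).
It is the graph of the Wiener integral. -/
noncomputable def wienerGraph (hW : IsPreBrownianReal W P) :
    Submodule ℝ (Lp ℝ 2 unitVol × Lp ℝ 2 P) :=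
  (Submodule.span ℝ (range fun t ↦ (indIic t, evalLp hW t))).topologicalClosure

/-- The induction principle for the graph: a closed condition need only be checked on finite linear
combinations, that is, on step functions and the matching combinations of Brownian values. -/
theorem mem_wienerGraph_of_closed (hW : IsPreBrownianReal W P)
    {C : Lp ℝ 2 unitVol × Lp ℝ 2 P → Prop} (hC : IsClosed {p | C p})
    (h : ∀ a : unitInterval →₀ ℝ,
      C (∑ t ∈ a.support, a t • indIic t, ∑ t ∈ a.support, a t • evalLp hW t))
    {p : Lp ℝ 2 unitVol × Lp ℝ 2 P} (hp : p ∈ wienerGraph hW) : C p := by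
  refine closure_minimal ?_ hC hp
  intro q hq
  obtain ⟨a, rfl⟩ := Finsupp.mem_span_range_iff_exists_finsupp.1 hq
  have := h a
  simp only [mem_ofPred_eq]
  convert this using 1
  ext1 <;> simp [Finsupp.sum, Prod.fst_sum, Prod.snd_sum]

theorem norm_eq_of_mem_wienerGraph (hW : IsPreBrownianReal W P)
    {p : Lp ℝ 2 unitVol × Lp ℝ 2 P} (hp : p ∈ wienerGraph hW) : ‖p.1‖ = ‖p.2‖ := by
  refine mem_wienerGraph_of_closed hW (C := fun p ↦ ‖p.1‖ = ‖p.2‖)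
    (isClosed_eq (by fun_prop) (by fun_prop)) (fun a ↦ ?_) hp
  rw [← sq_eq_sq₀ (norm_nonneg _) (norm_nonneg _), ← real_inner_self_eq_norm_sq,
    ← real_inner_self_eq_norm_sq]
  simp only [sum_inner, inner_sum, real_inner_smul_left, real_inner_smul_right,
    inner_indIic_indIic, inner_evalLp_evalLp]

/-- The first projection of the graph is an isometry on a complete space, so its range is closed; it
contains the dense span of the indicators, so it is everything. -/
theorem exists_mem_wienerGraph (hW : IsPreBrownianReal W P) (h : Lp ℝ 2 unitVol) :
    ∃ X, (h, X) ∈ wienerGraph hW := by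
  let L : wienerGraph hW →ₗ[ℝ] Lp ℝ 2 unitVol := LinearMap.fst ℝ _ _ ∘ₗ (wienerGraph hW).subtype
  have hiso : Isometry L := by
    refine AddMonoidHomClass.isometry_of_norm L fun p ↦ ?_
    have := norm_eq_of_mem_wienerGraph hW p.2
    -- The product carries the sup norm, which agrees with the norm of either coordinate by the Itô
    -- isometry.
    change ‖p.1.1‖ = max ‖p.1.1‖ ‖p.1.2‖
    rw [← this, max_self]
  have : CompleteSpace (wienerGraph hW) :=
    (Submodule.isClosed_topologicalClosure _).completeSpace_coe
  have hcl : IsClosed (LinearMap.range L : Set (Lp ℝ 2 unitVol)) := by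
    have := hiso.isClosedEmbedding.isClosed_range
    rwa [LinearMap.coe_range]
  have hsub : Submodule.span ℝ (range indIic) ≤ LinearMap.range L := by
    rw [Submodule.span_le]
    rintro _ ⟨t, rfl⟩
    exact ⟨⟨(indIic t, evalLp hW t),
      Submodule.le_topologicalClosure _ (Submodule.subset_span ⟨t, rfl⟩)⟩, rfl⟩
  have htop : (Submodule.span ℝ (range indIic)).topologicalClosure = ⊤ :=
    Submodule.topologicalClosure_eq_top_iff.2 span_indIic_orthogonal
  have hle := Submodule.topologicalClosure_minimal _ hsub hcl
  rw [htop] at hle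
  obtain ⟨p, hp⟩ := hle (Submodule.mem_top (x := h))
  refine ⟨p.1.2, ?_⟩
  have : (h, p.1.2) = p.1 := by rw [← hp]; rfl
  rw [this]
  exact p.2

/-- The map x ↦ exp(ix) is 1-Lipschitz, and the L¹ norm is at most the L² norm on a probability
space. -/
theorem continuous_integral_cexp [IsProbabilityMeasure P] :
    Continuous fun X : Lp ℝ 2 P ↦ ∫ w, Complex.exp (Complex.I * (X w : ℝ)) ∂P := by
  have hint (X : Lp ℝ 2 P) : Integrable (fun w ↦ Complex.exp (Complex.I * (X w : ℝ))) P := by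
    refine (integrable_const (1 : ℝ)).mono ?_ ?_
    · have := Lp.aestronglyMeasurable X
      have hc : Continuous fun x : ℝ ↦ Complex.exp (Complex.I * x) := by fun_prop
      exact hc.comp_aestronglyMeasurable this
    · refine Filter.Eventually.of_forall fun w ↦ ?_
      rw [Complex.norm_exp_I_mul_ofReal]; simp
  refine (LipschitzWith.of_dist_le_mul (K := 1) fun X Y ↦ ?_).continuous
  rw [dist_eq_norm, ← integral_sub (hint X) (hint Y), NNReal.coe_one, one_mul, dist_eq_norm]
  have hb (a b : ℝ) : ‖Complex.exp (Complex.I * a) - Complex.exp (Complex.I * b)‖ ≤ ‖a - b‖ := by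
    have : Complex.exp (Complex.I * a) - Complex.exp (Complex.I * b)
        = Complex.exp (Complex.I * b) * (Complex.exp (Complex.I * (a - b : ℝ)) - 1) := by
      rw [mul_sub, ← Complex.exp_add, mul_one]; congr 2; push_cast; ring
    rw [this, norm_mul, Complex.norm_exp_I_mul_ofReal, one_mul]
    exact Real.norm_exp_I_mul_ofReal_sub_one_le
  have h1 : Integrable (fun w ↦ ‖X w - Y w‖) P := by
    have h2 := ((Lp.memLp X).sub (Lp.memLp Y)).integrable (by norm_num)
    exact h2.norm
  calc ‖∫ w, (Complex.exp (Complex.I * (X w : ℝ)) - Complex.exp (Complex.I * (Y w : ℝ))) ∂P‖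
      ≤ ∫ w, ‖X w - Y w‖ ∂P :=
        norm_integral_le_of_norm_le h1 (Filter.Eventually.of_forall fun w ↦ hb _ _)
    _ ≤ ‖X - Y‖ := by
        rw [Lp.norm_def]
        change ∫ w, ‖((X : Ω → ℝ) - Y) w‖ ∂P ≤ _
        rw [integral_norm_eq_lintegral_enorm
          ((Lp.aestronglyMeasurable X).sub (Lp.aestronglyMeasurable Y))]
        refine ENNReal.toReal_mono (Lp.eLpNorm_ne_top _) ?_
        rw [← eLpNorm_one_eq_lintegral_enorm,
          ← eLpNorm_congr_ae (Lp.coeFn_sub X Y)]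
        exact eLpNorm_le_eLpNorm_of_exponent_le (by norm_num) (Lp.aestronglyMeasurable _)

/-- Wiener integrals are centred Gaussian with variance ‖h‖². For step functions this is the
Gaussian process property, and both sides are continuous in L², so the formula passes to the
closure. -/
theorem integral_cexp_of_mem_wienerGraph (hW : IsPreBrownianReal W P)
    {p : Lp ℝ 2 unitVol × Lp ℝ 2 P} (hp : p ∈ wienerGraph hW) :
    ∫ w, Complex.exp (Complex.I * (p.2 w : ℝ)) ∂P = Complex.exp (-(‖p.1‖ ^ 2 / 2 : ℝ)) := by
  have := hW.isGaussianProcess.isProbabilityMeasure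
  rw [norm_eq_of_mem_wienerGraph hW hp]
  refine mem_wienerGraph_of_closed hW
    (C := fun p ↦ ∫ w, Complex.exp (Complex.I * (p.2 w : ℝ)) ∂P
      = Complex.exp (-(‖p.2‖ ^ 2 / 2 : ℝ)))
    (isClosed_eq (continuous_integral_cexp.comp continuous_snd) (by fun_prop)) (fun a ↦ ?_) hp
  set X : Lp ℝ 2 P := ∑ t ∈ a.support, a t • evalLp hW t with hX
  have hXae : (X : Ω → ℝ) =ᵐ[P] fun w ↦ ∑ t ∈ a.support, a t • W (toNN t) w := by
    have h1 := Lp.coeFn_finsetSum a.support fun t ↦ a t • evalLp hW t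
    have h2 : ∀ᵐ w ∂P, ∀ t : a.support, (a t • evalLp hW t : Lp ℝ 2 P) w = a t • W (toNN t) w := by
      rw [ae_all_iff]
      intro t
      filter_upwards [Lp.coeFn_smul (a t) (evalLp hW t), (memLp_eval hW (toNN t)).coeFn_toLp]
        with w h3 h4
      rw [h3, Pi.smul_apply, evalLp, h4]
    filter_upwards [h1, h2] with w h1 h2
    rw [hX, h1]
    simp only [Finset.sum_apply]
    exact Finset.sum_congr rfl fun t ht ↦ h2 ⟨t, ht⟩
  have hG : HasGaussianLaw (X : Ω → ℝ) P := by
    refine HasGaussianLaw.congr ?_ hXae.symm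
    exact ((hW.isGaussianProcess.comp_right toNN).smul a).hasGaussianLaw_fun_sum
  have hmean : P[X] = 0 := by
    rw [integral_congr_ae hXae]
    change ∫ w, ∑ t ∈ a.support, (a t • W (toNN t)) w ∂P = 0
    rw [integral_finsetSum _ fun t _ ↦ (hW.integrable_eval (toNN t)).smul (a t)]
    simp [integral_const_mul, hW.integral_eval]
  have h1 := hG.charFun_map_eq 1
  have h2 : (fun w ↦ inner ℝ (1 : ℝ) (X w)) = X := by ext; simp
  rw [h2, hmean, variance_of_integral_eq_zero hG.aemeasurable hmean, charFun_apply_real,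
    integral_map hG.aemeasurable (by fun_prop)] at h1
  have h3 : ∫ w, X w ^ 2 ∂P = ‖X‖ ^ 2 := by
    rw [← real_inner_self_eq_norm_sq, L2.inner_def]
    simp [pow_two]
  rw [h3] at h1
  convert h1 using 2
  · ext w; congr 1; push_cast; ring
  · push_cast; ring

end WienerIntegral

/-! ### Reduction of the white noise model to a Gaussian sequence model -/

section Reduction

/-- A finite measure on path space is determined by its finite-dimensional marginals, and each of
these by its characteristic function. -/
theorem measure_ext_of_integral_cexp {T : Type*} {μ ν : Measure (T → ℝ)} [IsFiniteMeasure μ]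
    [IsFiniteMeasure ν]
    (h : ∀ (J : Finset T) (a : J → ℝ),
      ∫ y, Complex.exp (Complex.I * (∑ j, a j * y j : ℝ)) ∂μ
        = ∫ y, Complex.exp (Complex.I * (∑ j, a j * y j : ℝ)) ∂ν) : μ = ν := by
  classical
  have hm (J : Finset T) : μ.map J.restrict = ν.map J.restrict := by
    apply Measure.ext_of_charFunDual
    ext L
    have hL (y : J → ℝ) : L y = ∑ j, L (Pi.single j 1) * y j := by
      conv_lhs => rw [← Finset.univ_sum_single y, map_sum]
      refine Finset.sum_congr rfl fun j _ ↦ ?_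
      have : Pi.single j (y j) = y j • (Pi.single j 1 : J → ℝ) := by
        rw [← Pi.single_smul, smul_eq_mul, mul_one]
      rw [this, map_smul, smul_eq_mul, mul_comm]
    have hc : Continuous fun y : J → ℝ ↦ Complex.exp (L y * Complex.I) := by fun_prop
    rw [charFunDual_apply, charFunDual_apply,
      integral_map (by fun_prop) hc.aestronglyMeasurable,
      integral_map (by fun_prop) hc.aestronglyMeasurable]
    have e (y : J → ℝ) : Complex.exp (L y * Complex.I)
        = Complex.exp (Complex.I * (∑ j, L (Pi.single j 1) * y j : ℝ)) := by
      rw [hL y, mul_comm]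
    rw [integral_congr_ae (.of_forall fun x ↦ e _), integral_congr_ae (.of_forall fun x ↦ e _)]
    exact h J fun j ↦ L (Pi.single j 1)
  have h1 : IsProjectiveLimit μ (fun J ↦ ν.map J.restrict) := fun J ↦ hm J
  exact h1.unique fun J ↦ rfl

variable {Ω : Type*} [MeasurableSpace Ω] {P : Measure Ω} {W : ℝ≥0 → Ω → ℝ}
variable {ι : Type*} [Fintype ι]

/-- By linearity the random variable is itself a Wiener integral. The case c = 0 handles the path,
and c_k = ⟨g, Φ_k⟩ handles the residual left after projection. -/
theorem integral_cexp_eval_sub_sum (hW : IsPreBrownianReal W P) {Φ : ι → Lp ℝ 2 unitVol}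
    {ξ : ι → Lp ℝ 2 P} (hξ : ∀ k, (Φ k, ξ k) ∈ wienerGraph hW) (J : Finset unitInterval)
    (a : J → ℝ) (c : ι → ℝ) (s : ℝ) :
    ∫ w, Complex.exp (Complex.I * (s * (∑ j, a j * W (toNN j) w - ∑ k, c k * ξ k w) : ℝ)) ∂P
      = Complex.exp (-(s ^ 2 * ‖∑ j, a j • indIic j - ∑ k, c k • Φ k‖ ^ 2 / 2 : ℝ)) := by
  have hp : s • (∑ j, a j • (indIic (j : unitInterval), evalLp hW j) - ∑ k, c k • (Φ k, ξ k))
      ∈ wienerGraph hW := by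
    refine Submodule.smul_mem _ _ (Submodule.sub_mem _ (Submodule.sum_mem _ fun j _ ↦
      Submodule.smul_mem _ _ ?_) (Submodule.sum_mem _ fun k _ ↦ Submodule.smul_mem _ _ (hξ k)))
    exact Submodule.le_topologicalClosure _ (Submodule.subset_span ⟨j, rfl⟩)
  have h1 := integral_cexp_of_mem_wienerGraph hW hp
  have e1 : (s • (∑ j, a j • (indIic (j : unitInterval), evalLp hW j)
      - ∑ k, c k • (Φ k, ξ k))).1 = s • (∑ j, a j • indIic j - ∑ k, c k • Φ k) := by
    simp [Prod.fst_sum]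
  have e2 : (s • (∑ j, a j • (indIic (j : unitInterval), evalLp hW j)
      - ∑ k, c k • (Φ k, ξ k))).2 = s • (∑ j, a j • evalLp hW j - ∑ k, c k • ξ k) := by
    simp [Prod.snd_sum]
  rw [e1, e2, norm_smul, mul_pow, Real.norm_eq_abs, sq_abs] at h1
  rw [← h1]
  refine integral_congr_ae ?_
  have h2 : ∀ᵐ w ∂P, ∀ j : J, (a j • evalLp hW j : Lp ℝ 2 P) w = a j * W (toNN j) w := by
    rw [ae_all_iff]
    intro j
    filter_upwards [Lp.coeFn_smul (a j) (evalLp hW j), (memLp_eval hW (toNN j)).coeFn_toLp]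
      with w h3 h4
    rw [h3, Pi.smul_apply, evalLp, h4, smul_eq_mul]
  have h3 : ∀ᵐ w ∂P, ∀ k, (c k • ξ k : Lp ℝ 2 P) w = c k * ξ k w := by
    rw [ae_all_iff]
    intro k
    filter_upwards [Lp.coeFn_smul (c k) (ξ k)] with w h3
    rw [h3, Pi.smul_apply, smul_eq_mul]
  filter_upwards [h2, h3, Lp.coeFn_finsetSum Finset.univ fun j : J ↦ a j • evalLp hW j,
    Lp.coeFn_finsetSum Finset.univ fun k ↦ c k • ξ k,
    Lp.coeFn_sub (∑ j, a j • evalLp hW j) (∑ k, c k • ξ k),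
    Lp.coeFn_smul s (∑ j, a j • evalLp hW j - ∑ k, c k • ξ k)] with w h2 h3 h4 h5 h6 h7
  rw [h7, Pi.smul_apply, h6, Pi.sub_apply, h4, h5, smul_eq_mul]
  simp only [Finset.sum_apply, h2, h3]

/-- Pythagoras for the projection onto the span. Probabilistically, it splits the variance of a path
functional between the Gaussian vector and the residual noise. -/
theorem norm_sq_sub_sum_inner_smul {E : Type*} [NormedAddCommGroup E] [InnerProductSpace ℝ E]
    {Φ : ι → E} (hΦ : Orthonormal ℝ Φ) (g : E) :
    ‖g - ∑ k, inner ℝ g (Φ k) • Φ k‖ ^ 2 + ∑ k, inner ℝ g (Φ k) ^ 2 = ‖g‖ ^ 2 := by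
  classical
  rw [norm_sub_sq_real, ← real_inner_self_eq_norm_sq (∑ k, inner ℝ g (Φ k) • Φ k),
    hΦ.inner_sum, inner_sum]
  simp only [real_inner_smul_right, conj_trivial, ← pow_two]
  ring

theorem integral_cexp_pi_gaussianReal (θ : ι → ℝ) (v : ℝ≥0) (c : ι → ℝ) :
    ∫ y, Complex.exp (Complex.I * (∑ k, c k * y k : ℝ)) ∂(Measure.pi fun k ↦ gaussianReal (θ k) v)
      = Complex.exp (Complex.I * (∑ k, c k * θ k : ℝ) - (v * ∑ k, c k ^ 2 : ℝ) / 2) := by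
  have h1 (y : ι → ℝ) : Complex.exp (Complex.I * (∑ k, c k * y k : ℝ))
      = ∏ k, Complex.exp (c k * y k * Complex.I) := by
    rw [← Complex.exp_sum]
    congr 1
    push_cast
    rw [Finset.mul_sum]
    exact Finset.sum_congr rfl fun k _ ↦ by ring
  simp only [h1]
  rw [integral_fintype_prod_eq_prod fun k (x : ℝ) ↦ Complex.exp (c k * x * Complex.I)]
  simp only [← charFun_apply_real, charFun_gaussianReal]
  rw [← Complex.exp_sum, Finset.sum_sub_distrib]
  congr 2
  · push_cast
    rw [Finset.mul_sum]
    exact Finset.sum_congr rfl fun k _ ↦ by ring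
  · push_cast
    rw [Finset.mul_sum, Finset.sum_div]

/-- Along a linear family spanned by an orthonormal system, the observed path is a measurable
function of a Gaussian vector, whose mean is the parameter, and of an independent variable whose
law does not depend on the parameter. -/
theorem exists_map_path_eq (hW : IsPreBrownianReal W P) (hWm : ∀ t, Measurable (W t))
    {φ : ι → ℝ → ℝ} (hφ : ∀ k, MemLp (φ k) 2 unitVol)
    (horth : Orthonormal ℝ fun k ↦ (hφ k).toLp) {n : ℕ} :
    ∃ S : (ι → ℝ) × Ω → unitInterval → ℝ, Measurable S ∧ ∀ θ : ι → ℝ,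
      P.map (path n W fun x ↦ ∑ k, θ k * φ k x)
        = ((Measure.pi fun k ↦ gaussianReal (θ k) (n : ℝ≥0)⁻¹).prod P).map S := by
  have := hW.isGaussianProcess.isProbabilityMeasure
  choose ξ hξ using fun k ↦ exists_mem_wienerGraph hW (hφ k).toLp
  set s : ℝ := (n : ℝ) ^ (-(1 / 2) : ℝ) with hs
  have hs2 : s ^ 2 = (n : ℝ)⁻¹ := by
    rw [hs, ← Real.rpow_natCast, ← Real.rpow_mul (Nat.cast_nonneg n)]
    norm_num [Real.rpow_neg_one]
  set ψ : ι → unitInterval → ℝ := fun k t ↦ ∫ x in (0 : ℝ)..t, φ k x with hψ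
  have hii (k : ι) (t : unitInterval) : IntervalIntegrable (φ k) volume 0 t := by
    rw [intervalIntegrable_iff_integrableOn_Icc_of_le t.2.1]
    exact IntegrableOn.mono_set ((hφ k).integrable (by norm_num)) (Icc_subset_Icc_right t.2.2)
  have hψi (k : ι) (t : unitInterval) : inner ℝ (indIic t) (hφ k).toLp = ψ k t := by
    rw [inner_indIic_left, hψ]
    refine intervalIntegral.integral_congr_ae ?_
    have h1 := (ae_restrict_iff' measurableSet_Icc).1 (hφ k).coeFn_toLp
    filter_upwards [h1] with x hx hxt
    rw [uIoc_of_le t.2.1] at hxt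
    exact hx ⟨hxt.1.le, hxt.2.trans t.2.2⟩
  have hpath (θ : ι → ℝ) (w : Ω) (t : unitInterval) :
      path n W (fun x ↦ ∑ k, θ k * φ k x) w t = ∑ k, θ k * ψ k t + s * W (toNN t) w := by
    rw [path, intervalIntegral.integral_finsetSum fun k _ ↦ (hii k t).const_mul _]
    simp only [intervalIntegral.integral_const_mul]
    rfl
  have hξm (k : ι) : Measurable (ξ k) := (Lp.stronglyMeasurable (ξ k)).measurable
  -- Rebuild the path from the sufficient vector: y replaces the noisy coefficients, and the rest of
  -- the noise is Brownian motion minus its projection onto the Wiener integrals ξ_k. That residual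
  -- does not involve θ.
  let S : (ι → ℝ) × Ω → unitInterval → ℝ := fun p t ↦
    ∑ k, p.1 k * ψ k t + s * (W (toNN t) p.2 - ∑ k, ψ k t * ξ k p.2)
  have hSm : Measurable S := by
    refine measurable_pi_lambda _ fun t ↦ ?_
    have h1 := hWm (toNN t)
    fun_prop
  refine ⟨S, hSm, fun θ ↦ ?_⟩
  have hpm : Measurable (path n W fun x ↦ ∑ k, θ k * φ k x) := by
    refine measurable_pi_lambda _ fun t ↦ ?_
    simp only [hpath]
    have h1 := hWm (toNN t)
    fun_prop
  have := Measure.isProbabilityMeasure_map (μ := P) hpm.aemeasurable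
  have := Measure.isProbabilityMeasure_map
    (μ := (Measure.pi fun k ↦ gaussianReal (θ k) (n : ℝ≥0)⁻¹).prod P) hSm.aemeasurable
  refine measure_ext_of_integral_cexp fun J a ↦ ?_
  have hFm : Measurable fun y : unitInterval → ℝ ↦
      Complex.exp (Complex.I * (∑ j : J, a j * y j : ℝ)) := by fun_prop
  rw [integral_map hpm.aemeasurable hFm.aestronglyMeasurable,
    integral_map hSm.aemeasurable hFm.aestronglyMeasurable]
  set c : ι → ℝ := fun k ↦ ∑ j, a j * ψ k j with hc
  set g : Lp ℝ 2 unitVol := ∑ j, a j • indIic (j : unitInterval) with hg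
  have hcg (k : ι) : c k = inner ℝ g (hφ k).toLp := by
    rw [hc, hg, sum_inner]
    simp only [real_inner_smul_left, hψi]
  -- The sum with zero coefficients is inserted so that the same formula evaluates both
  -- characteristic functions.
  have hL (w : Ω) : Complex.exp (Complex.I *
      (∑ j : J, a j * path n W (fun x ↦ ∑ k, θ k * φ k x) w j : ℝ))
      = Complex.exp (Complex.I * (∑ k, c k * θ k : ℝ)) * Complex.exp (Complex.I *
        (s * (∑ j : J, a j * W (toNN j) w - ∑ k, (0 : ι → ℝ) k * ξ k w) : ℝ)) := by
    rw [← Complex.exp_add, ← mul_add, ← Complex.ofReal_add]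
    congr 3
    simp only [hpath, mul_add, Finset.sum_add_distrib, hc, Finset.sum_mul, Finset.mul_sum,
      Pi.zero_apply, zero_mul, Finset.sum_const_zero, sub_zero]
    rw [Finset.sum_comm]
    congr 1
    · exact Finset.sum_congr rfl fun _ _ ↦ Finset.sum_congr rfl fun _ _ ↦ by ring
    · exact Finset.sum_congr rfl fun _ _ ↦ by ring
  have hR (p : (ι → ℝ) × Ω) : Complex.exp (Complex.I * (∑ j : J, a j * S p j : ℝ))
      = Complex.exp (Complex.I * (∑ k, c k * p.1 k : ℝ)) * Complex.exp (Complex.I *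
        (s * (∑ j : J, a j * W (toNN j) p.2 - ∑ k, c k * ξ k p.2) : ℝ)) := by
    rw [← Complex.exp_add, ← mul_add, ← Complex.ofReal_add]
    congr 3
    simp only [S, mul_add, Finset.sum_add_distrib, hc, Finset.sum_mul, Finset.mul_sum, mul_sub,
      Finset.sum_sub_distrib]
    rw [Finset.sum_comm]
    congr 1
    · exact Finset.sum_congr rfl fun _ _ ↦ Finset.sum_congr rfl fun _ _ ↦ by ring
    · congr 1
      · exact Finset.sum_congr rfl fun _ _ ↦ by ring
      · rw [Finset.sum_comm]
        exact Finset.sum_congr rfl fun _ _ ↦ Finset.sum_congr rfl fun _ _ ↦ by ring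
  simp only [hL, hR]
  rw [integral_const_mul, integral_cexp_eval_sub_sum hW hξ,
    integral_prod_mul (μ := Measure.pi fun k ↦ gaussianReal (θ k) (n : ℝ≥0)⁻¹) (ν := P)
      (fun y ↦ Complex.exp (Complex.I * (∑ k, c k * y k : ℝ)))
      (fun w ↦ Complex.exp (Complex.I *
        (s * (∑ j : J, a j * W (toNN j) w - ∑ k, c k * ξ k w) : ℝ))),
    integral_cexp_eval_sub_sum hW hξ, integral_cexp_pi_gaussianReal, ← Complex.exp_add,
    ← Complex.exp_add]
  -- The path has variance s²‖g‖²; the reconstruction has s² times the residual norm squared from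
  -- the noise, plus ∑ c_k² / n from y. These agree by Pythagoras, since s² = 1/n.
  have h2 := norm_sq_sub_sum_inner_smul horth g
  simp only [← hcg] at h2
  congr 1
  simp only [Pi.zero_apply, zero_smul, Finset.sum_const_zero, sub_zero]
  rw [sub_add, sub_eq_add_neg]
  congr 1
  rw [← h2, hs2]
  push_cast
  ring

end Reduction

/-! ### A smooth radial prior, and integration by parts against the Gaussian density -/

section Prior

variable {ι : Type*} [Fintype ι]

/-- A smooth function of `∑ θ_k²`, equal to one if `∑ θ_k² ≤ a` and to zero if `∑ θ_k² ≥ b`. -/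
noncomputable def radialPrior (a b : ℝ) (θ : ι → ℝ) : ℝ :=
  Real.smoothTransition ((b - ∑ k, θ k ^ 2) / (b - a))

/-- The gradient of the radial prior at `θ` is `-radialWeight a b θ • θ`. -/
noncomputable def radialWeight (a b : ℝ) (θ : ι → ℝ) : ℝ :=
  2 / (b - a) * deriv Real.smoothTransition ((b - ∑ k, θ k ^ 2) / (b - a))

variable {a b : ℝ}

theorem hasFDerivAt_sum_sq (θ : ι → ℝ) :
    HasFDerivAt (fun θ : ι → ℝ ↦ ∑ k, θ k ^ 2)
      (∑ k, (2 * θ k) • ContinuousLinearMap.proj (R := ℝ) (φ := fun _ : ι ↦ ℝ) k) θ := by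
  refine HasFDerivAt.fun_sum fun k _ ↦ ?_
  have h := ((ContinuousLinearMap.proj (R := ℝ) (φ := fun _ : ι ↦ ℝ) k).hasFDerivAt (x := θ)).pow 2
  simpa using h

theorem continuous_radialPrior : Continuous (radialPrior a b : (ι → ℝ) → ℝ) := by
  have := Real.smoothTransition.continuous
  unfold radialPrior
  fun_prop

theorem continuous_deriv_smoothTransition : Continuous (deriv Real.smoothTransition) :=
  (Real.smoothTransition.contDiff (n := 1)).continuous_deriv le_rfl

theorem continuous_radialWeight : Continuous (radialWeight a b : (ι → ℝ) → ℝ) := by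
  have := continuous_deriv_smoothTransition
  unfold radialWeight
  fun_prop

theorem hasFDerivAt_radialPrior (θ : ι → ℝ) :
    HasFDerivAt (radialPrior a b) (-radialWeight a b θ • ∑ k, θ k •
      ContinuousLinearMap.proj (R := ℝ) (φ := fun _ : ι ↦ ℝ) k) θ := by
  have h1 : HasDerivAt Real.smoothTransition
      (deriv Real.smoothTransition ((b - ∑ k, θ k ^ 2) / (b - a)))
      ((b - ∑ k, θ k ^ 2) / (b - a)) :=
    ((Real.smoothTransition.contDiff (n := 1)).differentiable (by norm_num) _).hasDerivAt
  have h2 := ((hasFDerivAt_sum_sq θ).const_sub b).const_mul (b - a)⁻¹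
  simp only [← div_eq_inv_mul] at h2
  have h4 := h1.comp_hasFDerivAt θ h2
  refine HasFDerivAt.congr_fderiv (f := radialPrior a b) h4 (ContinuousLinearMap.ext fun x ↦ ?_)
  simp only [radialWeight, smul_apply, sum_apply,
    ContinuousLinearMap.proj_apply, smul_eq_mul, neg_apply, mul_assoc,
    ← Finset.mul_sum]
  ring

theorem radialPrior_nonneg (θ : ι → ℝ) : 0 ≤ radialPrior a b θ :=
  Real.smoothTransition.nonneg _

theorem radialWeight_nonneg (hab : a < b) (θ : ι → ℝ) : 0 ≤ radialWeight a b θ :=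
  mul_nonneg (div_nonneg zero_le_two (sub_nonneg.2 hab.le))
    Real.smoothTransition.monotone.deriv_nonneg

theorem radialPrior_eq_zero (hab : a < b) {θ : ι → ℝ} (h : b ≤ ∑ k, θ k ^ 2) :
    radialPrior a b θ = 0 :=
  Real.smoothTransition.zero_of_nonpos
    (div_nonpos_of_nonpos_of_nonneg (sub_nonpos.2 h) (sub_nonneg.2 hab.le))

theorem deriv_smoothTransition_of_nonpos {x : ℝ} (hx : x ≤ 0) :
    deriv Real.smoothTransition x = 0 := by
  have h : EqOn (deriv Real.smoothTransition) (fun _ ↦ 0) (Iio 0) := by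
    intro y hy
    have : Real.smoothTransition =ᶠ[nhds y] fun _ ↦ 0 := by
      filter_upwards [Iio_mem_nhds hy] with z hz
      exact Real.smoothTransition.zero_of_nonpos (le_of_lt hz)
    rw [this.deriv_eq]; simp
  have h2 := h.closure continuous_deriv_smoothTransition continuous_const
  rw [closure_Iio] at h2
  exact h2 hx

theorem deriv_smoothTransition_of_one_lt {x : ℝ} (hx : 1 < x) :
    deriv Real.smoothTransition x = 0 := by
  have : Real.smoothTransition =ᶠ[nhds x] fun _ ↦ 1 := by
    filter_upwards [Ioi_mem_nhds hx] with z hz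
    exact Real.smoothTransition.one_of_one_le (le_of_lt hz)
  rw [this.deriv_eq]; simp

theorem radialWeight_eq_zero (hab : a < b) {θ : ι → ℝ} (h : b ≤ ∑ k, θ k ^ 2) :
    radialWeight a b θ = 0 := by
  rw [radialWeight, deriv_smoothTransition_of_nonpos, mul_zero]
  exact div_nonpos_of_nonpos_of_nonneg (sub_nonpos.2 h) (sub_nonneg.2 hab.le)

/-- The plateau of the prior removes small signals from the boundary term. With a = 4B, the bias is
at most half the signal norm wherever the weight is nonzero. -/
theorem radialWeight_eq_zero_of_lt (hab : a < b) {θ : ι → ℝ} (h : ∑ k, θ k ^ 2 < a) :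
    radialWeight a b θ = 0 := by
  rw [radialWeight, deriv_smoothTransition_of_one_lt, mul_zero]
  rw [one_lt_div (sub_pos.2 hab)]
  linarith

theorem hasCompactSupport_of_sum_sq {f : (ι → ℝ) → ℝ} {b : ℝ}
    (hf : ∀ θ, b ≤ ∑ k, θ k ^ 2 → f θ = 0) : HasCompactSupport f := by
  refine HasCompactSupport.of_support_subset_isCompact
    (isCompact_univ_pi fun _ : ι ↦ isCompact_Icc (a := -√b) (b := √b)) fun θ hθ k _ ↦ ?_
  have h1 : ∑ k, θ k ^ 2 < b := by
    by_contra h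
    exact hθ (hf θ (not_lt.1 h))
  have h2 : θ k ^ 2 ≤ b :=
    (Finset.single_le_sum (fun j _ ↦ sq_nonneg (θ j)) (Finset.mem_univ k)).trans h1.le
  exact ⟨Real.neg_sqrt_le_of_sq_le h2, Real.le_sqrt_of_sq_le h2⟩

theorem hasCompactSupport_radialPrior (hab : a < b) :
    HasCompactSupport (radialPrior a b : (ι → ℝ) → ℝ) :=
  hasCompactSupport_of_sum_sq fun _ ↦ radialPrior_eq_zero hab

theorem hasCompactSupport_radialWeight (hab : a < b) :
    HasCompactSupport (radialWeight a b : (ι → ℝ) → ℝ) :=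
  hasCompactSupport_of_sum_sq fun _ ↦ radialWeight_eq_zero hab

theorem integral_radialPrior_pos (ha : 0 ≤ a) (hab : a < b) :
    0 < ∫ θ : ι → ℝ, radialPrior a b θ := by
  refine continuous_radialPrior.integral_pos_of_hasCompactSupport_nonneg_nonzero
    (hasCompactSupport_radialPrior hab) radialPrior_nonneg (x := 0) ?_
  rw [radialPrior, Real.smoothTransition.one_of_one_le]
  · exact one_ne_zero
  · rw [one_le_div (sub_pos.2 hab)]
    simpa using ha

/-- Integration by parts against the radial prior. -/
theorem integral_radialPrior_mul_fderiv (hab : a < b) {G : (ι → ℝ) → ℝ} (hG : ContDiff ℝ 1 G)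
    (c : ι → ℝ) :
    ∫ θ, radialPrior a b θ * fderiv ℝ G θ c
      = ∫ θ, radialWeight a b θ * (∑ k, θ k * c k) * G θ := by
  have hG0 := hG.continuous
  have hG1 : Continuous fun θ ↦ fderiv ℝ G θ c :=
    (hG.continuous_fderiv one_ne_zero).clm_apply continuous_const
  have hf (θ : ι → ℝ) : fderiv ℝ (radialPrior a b) θ c
      = -(radialWeight a b θ * ∑ k, θ k * c k) := by
    rw [(hasFDerivAt_radialPrior θ).fderiv]
    simp
  have hc1 := continuous_radialPrior (ι := ι) (a := a) (b := b)
  have hc2 := continuous_radialWeight (ι := ι) (a := a) (b := b)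
  rw [integral_mul_fderiv_eq_neg_fderiv_mul_of_integrable]
  · simp only [hf, neg_mul, integral_neg, neg_neg]
  · simp only [hf]
    refine Continuous.integrable_of_hasCompactSupport (by fun_prop) ?_
    exact ((hasCompactSupport_radialWeight hab).mul_right.neg).mul_right
  · exact Continuous.integrable_of_hasCompactSupport (by fun_prop)
      (hasCompactSupport_radialPrior hab).mul_right
  · exact Continuous.integrable_of_hasCompactSupport (by fun_prop)
      (hasCompactSupport_radialPrior hab).mul_right
  · exact fun θ _ ↦ (hasFDerivAt_radialPrior θ).differentiableAt
  · exact fun θ _ ↦ (hG.differentiable one_ne_zero) θ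

/-- Integration by parts against the identity vector field, whose divergence is the dimension. -/
theorem integral_radialWeight_mul_sum_sq (hab : a < b) :
    ∫ θ : ι → ℝ, radialWeight a b θ * ∑ k, θ k ^ 2
      = Fintype.card ι * ∫ θ : ι → ℝ, radialPrior a b θ := by
  classical
  have h (k : ι) : ∫ θ : ι → ℝ, radialWeight a b θ * θ k ^ 2 = ∫ θ : ι → ℝ, radialPrior a b θ := by
    have h1 := integral_radialPrior_mul_fderiv (ι := ι) hab
      (ContinuousLinearMap.proj (R := ℝ) (φ := fun _ : ι ↦ ℝ) k).contDiff (Pi.single k 1)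
    simp only [ContinuousLinearMap.fderiv, ContinuousLinearMap.proj_apply, Pi.single_eq_same,
      mul_one] at h1
    rw [h1]
    refine integral_congr_ae (.of_forall fun θ ↦ ?_)
    simp [Pi.single_apply]
    ring
  simp only [Finset.mul_sum]
  rw [integral_finsetSum]
  · simp [h]
  · intro k _
    have hc2 := continuous_radialWeight (ι := ι) (a := a) (b := b)
    exact Continuous.integrable_of_hasCompactSupport (by fun_prop)
      (hasCompactSupport_radialWeight hab).mul_right

/-- The density of the Gaussian distribution with mean `θ` and covariance `v` times the
identity. -/
noncomputable def gaussDensity (v : ℝ≥0) (θ y : ι → ℝ) : ℝ :=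
  ∏ k, gaussianPDFReal (θ k) v (y k)

theorem gaussDensity_nonneg (v : ℝ≥0) (θ y : ι → ℝ) : 0 ≤ gaussDensity v θ y :=
  Finset.prod_nonneg fun _ _ ↦ gaussianPDFReal_nonneg _ _ _

theorem gaussDensity_eq (v : ℝ≥0) (θ y : ι → ℝ) :
    gaussDensity v θ y = (√(2 * Real.pi * v))⁻¹ ^ Fintype.card ι
      * Real.exp (-(∑ k, (y k - θ k) ^ 2) / (2 * v)) := by
  simp only [gaussDensity, gaussianPDFReal_def]
  rw [Finset.prod_mul_distrib, ← Real.exp_sum]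
  simp only [Finset.prod_const, Finset.card_univ, Finset.sum_div, neg_div, Finset.sum_neg_distrib]

theorem continuous_gaussDensity (v : ℝ≥0) :
    Continuous fun p : (ι → ℝ) × (ι → ℝ) ↦ gaussDensity v p.1 p.2 := by
  simp only [gaussDensity_eq]
  fun_prop

theorem contDiff_gaussDensity (v : ℝ≥0) (y : ι → ℝ) :
    ContDiff ℝ 1 fun θ ↦ gaussDensity v θ y := by
  simp only [gaussDensity_eq]
  fun_prop

theorem fderiv_gaussDensity (v : ℝ≥0) (y θ c : ι → ℝ) :
    fderiv ℝ (fun θ ↦ gaussDensity v θ y) θ c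
      = gaussDensity v θ y * ((∑ k, (y k - θ k) * c k) / v) := by
  have h0 := (hasFDerivAt_sum_sq (y - θ)).comp θ ((hasFDerivAt_id θ).const_sub y)
  change HasFDerivAt (fun θ : ι → ℝ ↦ ∑ k, (y k - θ k) ^ 2) _ θ at h0
  have h1 := ((h0.const_mul (-(2 * (v : ℝ))⁻¹)).exp).const_mul
    ((√(2 * Real.pi * v))⁻¹ ^ Fintype.card ι)
  have h2 := h1.congr_of_eventuallyEq (f₁ := fun θ ↦ gaussDensity v θ y) <| by
    refine .of_forall fun θ ↦ ?_
    simp only [gaussDensity_eq]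
    congr 2
    ring
  rw [h2.fderiv, gaussDensity_eq]
  have e : -(∑ k, (y k - θ k) ^ 2) / (2 * v) = -(2 * (v : ℝ))⁻¹ * ∑ k, (y k - θ k) ^ 2 := by ring
  rw [e]
  simp only [smul_apply, ContinuousLinearMap.comp_apply,
    sum_apply, ContinuousLinearMap.proj_apply, smul_eq_mul,
    neg_apply, Pi.sub_apply, ContinuousLinearMap.id_apply, Pi.neg_apply,
    mul_assoc, ← Finset.mul_sum, mul_neg, Finset.sum_neg_distrib]
  ring

/-- The score identity, integrated by parts in the parameter with the data fixed. An estimator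
depends on y alone, so it factors out and needs no smoothness. -/
theorem integral_radialPrior_mul_gaussDensity (hab : a < b) {v : ℝ≥0} (y c : ι → ℝ) :
    ∫ θ, radialPrior a b θ * (gaussDensity v θ y * ((∑ k, (y k - θ k) * c k) / v))
      = ∫ θ, radialWeight a b θ * (∑ k, θ k * c k) * gaussDensity v θ y := by
  rw [← integral_radialPrior_mul_fderiv hab (contDiff_gaussDensity v y) c]
  simp only [fderiv_gaussDensity]

theorem pi_gaussianReal_eq_withDensity {v : ℝ≥0} (hv : v ≠ 0) (θ : ι → ℝ) :
    Measure.pi (fun k ↦ gaussianReal (θ k) v)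
      = volume.withDensity fun y ↦ ENNReal.ofReal (gaussDensity v θ y) := by
  refine Measure.pi_eq fun s hs ↦ ?_
  rw [withDensity_apply _ (MeasurableSet.univ_pi hs), volume_pi, Measure.restrict_pi_pi,
    ← ofReal_integral_eq_lintegral_ofReal]
  · simp only [gaussDensity]
    rw [integral_fintype_prod_eq_prod, ENNReal.ofReal_prod_of_nonneg]
    · exact Finset.prod_congr rfl fun k _ ↦ (gaussianReal_apply_eq_integral _ hv _).symm
    · exact fun k _ ↦ integral_nonneg fun x ↦ gaussianPDFReal_nonneg _ _ _
  · exact Integrable.fintype_prod_dep fun k ↦ (integrable_gaussianPDFReal _ _).restrict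
  · exact .of_forall fun y ↦ gaussDensity_nonneg _ _ _

end Prior

/-! ### A lower bound for the integrated variance in a Gaussian sequence model -/

section SquareIntegrable

variable {α : Type*} [MeasurableSpace α] {μ : Measure α}

theorem lintegral_enorm_sq_eq_eLpNorm_sq (f : α → ℝ) (μ : Measure α) :
    ∫⁻ x, ‖f x‖ₑ ^ 2 ∂μ = eLpNorm f 2 μ ^ 2 := by
  rw [eLpNorm_eq_lintegral_rpow_enorm_toReal two_ne_zero ENNReal.ofNat_ne_top,
    ← ENNReal.rpow_natCast, ← ENNReal.rpow_mul]
  simp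

theorem memLp_two_iff_lintegral {f : α → ℝ} (hf : AEStronglyMeasurable f μ) :
    MemLp f 2 μ ↔ ∫⁻ x, ‖f x‖ₑ ^ 2 ∂μ ≠ ⊤ := by
  rw [lintegral_enorm_sq_eq_eLpNorm_sq, MemLp, and_iff_right hf, lt_top_iff_ne_top]
  simp

theorem lintegral_enorm_sq_eq_ofReal {f : α → ℝ} (hf : MemLp f 2 μ) :
    ∫⁻ x, ‖f x‖ₑ ^ 2 ∂μ = ENNReal.ofReal (∫ x, f x ^ 2 ∂μ) := by
  rw [ofReal_integral_eq_lintegral_ofReal hf.integrable_sq (.of_forall fun x ↦ sq_nonneg _)]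
  refine lintegral_congr fun x ↦ ?_
  rw [← ofReal_norm, ← ENNReal.ofReal_pow (norm_nonneg _), Real.norm_eq_abs, sq_abs]

theorem integral_sq_eq_toReal {f : α → ℝ} (hf : MemLp f 2 μ) :
    ∫ x, f x ^ 2 ∂μ = (∫⁻ x, ‖f x‖ₑ ^ 2 ∂μ).toReal := by
  rw [lintegral_enorm_sq_eq_ofReal hf, ENNReal.toReal_ofReal (integral_nonneg fun _ ↦ sq_nonneg _)]

theorem enorm_add_sq_le (a b : ℝ) : ‖a + b‖ₑ ^ 2 ≤ 2 * ‖a‖ₑ ^ 2 + 2 * ‖b‖ₑ ^ 2 := by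
  simp only [← ofReal_norm, ← ENNReal.ofReal_pow (norm_nonneg _)]
  rw [show (2 : ℝ≥0∞) = ENNReal.ofReal 2 by simp, ← ENNReal.ofReal_mul zero_le_two,
    ← ENNReal.ofReal_mul zero_le_two, ← ENNReal.ofReal_add (by positivity) (by positivity)]
  refine ENNReal.ofReal_le_ofReal ?_
  simp only [Real.norm_eq_abs, sq_abs]
  nlinarith [sq_nonneg (a - b)]

theorem enorm_mul_le_add_sq (a b : ℝ) : ‖a * b‖ₑ ≤ ‖a‖ₑ ^ 2 + ‖b‖ₑ ^ 2 := by
  simp only [← ofReal_norm, ← ENNReal.ofReal_pow (norm_nonneg _)]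
  rw [← ENNReal.ofReal_add (by positivity) (by positivity)]
  refine ENNReal.ofReal_le_ofReal ?_
  rw [norm_mul]
  nlinarith [sq_nonneg (‖a‖ - ‖b‖), sq_nonneg (‖a‖ + ‖b‖)]

theorem integrable_mul_of_memLp {f g : α → ℝ} (hf : MemLp f 2 μ) (hg : MemLp g 2 μ) :
    Integrable (fun x ↦ f x * g x) μ :=
  hf.integrable_mul hg

end SquareIntegrable

/-! ### Pairing an estimator with functions: bounds through bias and variance -/

section Risk

variable {E : Type*} [MeasurableSpace E] {Q : Measure E} [IsProbabilityMeasure Q]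
  {fhat : E → ℝ → ℝ}

theorem stronglyMeasurable_integral_fhat (hm : Measurable (Function.uncurry fhat)) :
    StronglyMeasurable fun x ↦ ∫ y, fhat y x ∂Q :=
  StronglyMeasurable.integral_prod_left hm.stronglyMeasurable

theorem measurable_fhat_sub_integral (hm : Measurable (Function.uncurry fhat)) :
    Measurable fun p : E × ℝ ↦ fhat p.1 p.2 - ∫ y, fhat y p.2 ∂Q :=
  hm.sub ((stronglyMeasurable_integral_fhat hm).measurable.comp measurable_snd)

theorem lintegral_integral_fhat_sq_le (hm : Measurable (Function.uncurry fhat)) {f : ℝ → ℝ}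
    (hf : AEMeasurable f unitVol) :
    ∫⁻ x, ‖∫ y, fhat y x ∂Q‖ₑ ^ 2 ∂unitVol
      ≤ 2 * iBiasSq Q fhat f + 2 * ∫⁻ x, ‖f x‖ₑ ^ 2 ∂unitVol := by
  have h1 := (stronglyMeasurable_integral_fhat (Q := Q) hm).measurable
  rw [iBiasSq, ← lintegral_const_mul' _ _ (by simp), ← lintegral_const_mul' _ _ (by simp),
    ← lintegral_add_right' _ ((hf.enorm.pow_const 2).const_mul 2)]
  refine lintegral_mono fun x ↦ ?_
  simpa using enorm_add_sq_le ((∫ y, fhat y x ∂Q) - f x) (f x)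

theorem lintegral_sub_integral_sq (hm : Measurable (Function.uncurry fhat)) :
    ∫⁻ p, ‖fhat p.1 p.2 - ∫ y, fhat y p.2 ∂Q‖ₑ ^ 2 ∂(Q.prod unitVol) = iVar Q fhat := by
  rw [lintegral_prod_symm' _ ((measurable_fhat_sub_integral hm).enorm.pow_const 2)]
  rfl

theorem lintegral_fhat_sq_le (hm : Measurable (Function.uncurry fhat)) {f : ℝ → ℝ}
    (hf : AEMeasurable f unitVol) :
    ∫⁻ p, ‖fhat p.1 p.2‖ₑ ^ 2 ∂(Q.prod unitVol)
      ≤ 2 * iVar Q fhat + 2 * (2 * iBiasSq Q fhat f + 2 * ∫⁻ x, ‖f x‖ₑ ^ 2 ∂unitVol) := by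
  have h1 := (stronglyMeasurable_integral_fhat (Q := Q) hm).measurable
  calc ∫⁻ p, ‖fhat p.1 p.2‖ₑ ^ 2 ∂(Q.prod unitVol)
      ≤ ∫⁻ p, (2 * ‖fhat p.1 p.2 - ∫ y, fhat y p.2 ∂Q‖ₑ ^ 2
          + 2 * ‖∫ y, fhat y p.2 ∂Q‖ₑ ^ 2) ∂(Q.prod unitVol) := by
        refine lintegral_mono fun p ↦ ?_
        simpa using enorm_add_sq_le (fhat p.1 p.2 - ∫ y, fhat y p.2 ∂Q) (∫ y, fhat y p.2 ∂Q)
    _ = 2 * iVar Q fhat + 2 * ∫⁻ x, ‖∫ y, fhat y x ∂Q‖ₑ ^ 2 ∂unitVol := by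
        rw [lintegral_add_left (((measurable_fhat_sub_integral hm).enorm.pow_const 2).const_mul 2),
          lintegral_const_mul' _ _ (by simp),
          lintegral_const_mul' _ _ (by simp), lintegral_sub_integral_sq hm]
        congr 2
        have h2 : Measurable fun p : E × ℝ ↦ ‖∫ y, fhat y p.2 ∂Q‖ₑ ^ 2 :=
          (h1.comp measurable_snd).enorm.pow_const 2
        rw [lintegral_prod_symm' _ h2]
        simp
    _ ≤ _ := by gcongr; exact lintegral_integral_fhat_sq_le hm hf

theorem memLp_integral_fhat (hm : Measurable (Function.uncurry fhat)) {f : ℝ → ℝ}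
    (hf : MemLp f 2 unitVol) (hb : iBiasSq Q fhat f ≠ ⊤) :
    MemLp (fun x ↦ ∫ y, fhat y x ∂Q) 2 unitVol := by
  rw [memLp_two_iff_lintegral (stronglyMeasurable_integral_fhat hm).aestronglyMeasurable]
  refine ne_top_of_le_ne_top ?_
    (lintegral_integral_fhat_sq_le hm hf.aestronglyMeasurable.aemeasurable)
  rw [lintegral_enorm_sq_eq_ofReal hf]
  finiteness

theorem memLp_fhat (hm : Measurable (Function.uncurry fhat)) {f : ℝ → ℝ}
    (hf : MemLp f 2 unitVol) (hb : iBiasSq Q fhat f ≠ ⊤) (hv : iVar Q fhat ≠ ⊤) :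
    MemLp (fun p : E × ℝ ↦ fhat p.1 p.2) 2 (Q.prod unitVol) := by
  refine (memLp_two_iff_lintegral hm.aestronglyMeasurable).2
    (ne_top_of_le_ne_top ?_ (lintegral_fhat_sq_le hm hf.aestronglyMeasurable.aemeasurable))
  rw [lintegral_enorm_sq_eq_ofReal hf]
  finiteness

/-- Since h is centred at each x, the estimator may be replaced by its deviation from its mean. The
finite bias and variance only secure square integrability. -/
theorem integral_fhat_mul_le (hm : Measurable (Function.uncurry fhat)) {f : ℝ → ℝ}
    (hf : MemLp f 2 unitVol) (hb : iBiasSq Q fhat f ≠ ⊤) (hv : iVar Q fhat ≠ ⊤)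
    {h : E × ℝ → ℝ} (hh : MemLp h 2 (Q.prod unitVol)) (h0 : ∀ x, ∫ y, h (y, x) ∂Q = 0) :
    ∫ p, fhat p.1 p.2 * h p ∂(Q.prod unitVol)
      ≤ (iVar Q fhat).toReal + (∫ p, h p ^ 2 ∂(Q.prod unitVol)) / 4 := by
  have hu := memLp_fhat hm hf hb hv
  have hM : MemLp (fun p : E × ℝ ↦ ∫ y, fhat y p.2 ∂Q) 2 (Q.prod unitVol) :=
    (memLp_integral_fhat hm hf hb).comp_measurePreserving measurePreserving_snd
  have hMh : ∫ p : E × ℝ, (∫ y, fhat y p.2 ∂Q) * h p ∂(Q.prod unitVol) = 0 := by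
    rw [integral_prod_symm _ (integrable_mul_of_memLp hM hh)]
    simp [integral_const_mul, h0]
  have hd : MemLp (fun p : E × ℝ ↦ fhat p.1 p.2 - ∫ y, fhat y p.2 ∂Q) 2 (Q.prod unitVol) :=
    hu.sub hM
  have e1 : ∫ p, fhat p.1 p.2 * h p ∂(Q.prod unitVol)
      = ∫ p, (fhat p.1 p.2 - ∫ y, fhat y p.2 ∂Q) * h p ∂(Q.prod unitVol) := by
    rw [← add_zero (∫ p, (fhat p.1 p.2 - ∫ y, fhat y p.2 ∂Q) * h p ∂(Q.prod unitVol)), ← hMh,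
      ← integral_add (integrable_mul_of_memLp hd hh) (integrable_mul_of_memLp hM hh)]
    refine integral_congr_ae (.of_forall fun p ↦ ?_)
    ring
  rw [e1, ← lintegral_sub_integral_sq hm]
  have e2 := integral_sq_eq_toReal hd
  rw [← e2, ← integral_div, ← integral_add hd.integrable_sq (hh.integrable_sq.div_const _)]
  refine integral_mono (integrable_mul_of_memLp hd hh)
    (hd.integrable_sq.add (hh.integrable_sq.div_const _)) fun p ↦ ?_
  -- This is dh ≤ d² + h²/4 for the deviation d; the weight 1/4 leaves half of the gain mv/2 in the
  -- final comparison.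
  nlinarith [sq_nonneg (fhat p.1 p.2 - (∫ y, fhat y p.2 ∂Q) - h p / 2)]

theorem le_integral_fhat_mul (hm : Measurable (Function.uncurry fhat)) {f : ℝ → ℝ}
    (hf : MemLp f 2 unitVol) (hv : iVar Q fhat ≠ ⊤) {B : ℝ}
    (hb : iBiasSq Q fhat f ≤ ENNReal.ofReal B) (hB : 4 * B ≤ ∫ x, f x ^ 2 ∂unitVol) :
    (∫ x, f x ^ 2 ∂unitVol) / 2 ≤ ∫ p, fhat p.1 p.2 * f p.2 ∂(Q.prod unitVol) := by
  have hb' : iBiasSq Q fhat f ≠ ⊤ := ne_top_of_le_ne_top ENNReal.ofReal_ne_top hb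
  have hu := memLp_fhat hm hf hb' hv
  have hM := memLp_integral_fhat hm hf hb'
  have hf2 : MemLp (fun p : E × ℝ ↦ f p.2) 2 (Q.prod unitVol) :=
    hf.comp_measurePreserving measurePreserving_snd
  rw [integral_prod_symm _ (integrable_mul_of_memLp hu hf2)]
  simp only [integral_mul_const]
  have hd : MemLp (fun x ↦ (∫ y, fhat y x ∂Q) - f x) 2 unitVol := hM.sub hf
  have hbr : ∫ x, ((∫ y, fhat y x ∂Q) - f x) ^ 2 ∂unitVol ≤ (∫ x, f x ^ 2 ∂unitVol) / 4 := by
    have e := integral_sq_eq_toReal hd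
    rw [e]
    refine ENNReal.toReal_le_of_le_ofReal ?_ (hb.trans ?_)
    · have : 0 ≤ ∫ x, f x ^ 2 ∂unitVol := integral_nonneg fun _ ↦ sq_nonneg _
      positivity
    · exact ENNReal.ofReal_le_ofReal (by linarith)
  -- With bias d, (f + d) f = 3f²/4 - d² + (d + f/2)². The bias costs at most a quarter of ∫ f², so
  -- half remains.
  have hmono : ∫ x, (f x ^ 2 * (3 / 4) - ((∫ y, fhat y x ∂Q) - f x) ^ 2) ∂unitVol
      ≤ ∫ x, (∫ y, fhat y x ∂Q) * f x ∂unitVol := by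
    refine integral_mono ((hf.integrable_sq.mul_const _).sub hd.integrable_sq)
      (integrable_mul_of_memLp hM hf) fun x ↦ ?_
    nlinarith [sq_nonneg ((∫ y, fhat y x ∂Q) - f x + f x / 2)]
  rw [integral_sub (hf.integrable_sq.mul_const _) hd.integrable_sq, integral_mul_const] at hmono
  linarith

end Risk

/-! ### The Gaussian sequence model and the averaged information inequality -/

section SequenceModel

variable {ι : Type*} [Fintype ι]

/-- The linear combination of the functions `φ k` with coefficients `c k`. -/
def comb (φ : ι → ℝ → ℝ) (c : ι → ℝ) : ℝ → ℝ := fun x ↦ ∑ k, c k * φ k x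

variable {φ : ι → ℝ → ℝ}

theorem memLp_comb (hφ : ∀ k, MemLp (φ k) 2 unitVol) (c : ι → ℝ) :
    MemLp (comb φ c) 2 unitVol :=
  memLp_finsetSum _ fun k _ ↦ (hφ k).const_mul (c k)

theorem integral_comb_sq_of_orthogonal [DecidableEq ι] (hφ : ∀ k, MemLp (φ k) 2 unitVol) {A : ℝ}
    (horth : ∀ j k, ∫ x, φ j x * φ k x ∂unitVol = if j = k then A else 0) (c : ι → ℝ) :
    ∫ x, comb φ c x ^ 2 ∂unitVol = A * ∑ k, c k ^ 2 := by
  have h (x : ℝ) : comb φ c x ^ 2 = ∑ j, ∑ k, c j * c k * (φ j x * φ k x) := by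
    rw [comb, pow_two, Finset.sum_mul_sum]
    exact Finset.sum_congr rfl fun _ _ ↦ Finset.sum_congr rfl fun _ _ ↦ by ring
  have hi (j k : ι) : Integrable (fun x ↦ c j * c k * (φ j x * φ k x)) unitVol :=
    (integrable_mul_of_memLp (hφ j) (hφ k)).const_mul _
  simp only [h]
  rw [integral_finsetSum _ fun j _ ↦ integrable_finsetSum _ fun k _ ↦ hi j k]
  simp only [integral_finsetSum _ fun k _ ↦ hi _ k, integral_const_mul, horth]
  simp [Finset.mul_sum, pow_two, mul_comm]

theorem integral_comb_sq [DecidableEq ι] (hφ : ∀ k, MemLp (φ k) 2 unitVol)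
    (horth : ∀ j k, ∫ x, φ j x * φ k x ∂unitVol = if j = k then 1 else 0) (c : ι → ℝ) :
    ∫ x, comb φ c x ^ 2 ∂unitVol = ∑ k, c k ^ 2 := by
  rw [integral_comb_sq_of_orthogonal hφ horth, one_mul]

/-- The joint law of a Gaussian vector with mean `θ` and covariance `v` times the identity and of
an independent variable with law `ρ`. -/
noncomputable def seqLaw {E' : Type*} [MeasurableSpace E'] (v : ℝ≥0) (ρ : Measure E')
    (θ : ι → ℝ) : Measure ((ι → ℝ) × E') :=
  (Measure.pi fun k ↦ gaussianReal (θ k) v).prod ρ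

variable {E' : Type*} [MeasurableSpace E'] {ρ : Measure E'} [IsProbabilityMeasure ρ] {v : ℝ≥0}

instance (θ : ι → ℝ) : IsProbabilityMeasure (seqLaw v ρ θ) := by
  unfold seqLaw; infer_instance

theorem measurePreserving_coord (θ : ι → ℝ) (k : ι) :
    MeasurePreserving (fun p : (ι → ℝ) × E' ↦ p.1 k) (seqLaw v ρ θ) (gaussianReal (θ k) v) :=
  (measurePreserving_eval (fun k ↦ gaussianReal (θ k) v) k).comp measurePreserving_fst

theorem memLp_coord_sub (θ : ι → ℝ) (k : ι) :
    MemLp (fun p : (ι → ℝ) × E' ↦ p.1 k - θ k) 2 (seqLaw v ρ θ) := by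
  have h : MemLp (fun x : ℝ ↦ x - θ k) 2 (gaussianReal (θ k) v) :=
    (memLp_id_gaussianReal 2).sub (memLp_const _)
  exact h.comp_measurePreserving (measurePreserving_coord θ k)

theorem integral_coord_sub (θ : ι → ℝ) (k : ι) :
    ∫ p, (p.1 k - θ k) ∂(seqLaw v ρ θ) = 0 := by
  have hp := measurePreserving_coord (ρ := ρ) (v := v) θ k
  have h := integral_map (μ := seqLaw v ρ θ) hp.measurable.aemeasurable
    (f := fun x : ℝ ↦ x - θ k) (by fun_prop)
  have hi : Integrable (fun x : ℝ ↦ x) (gaussianReal (θ k) v) :=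
    (memLp_id_gaussianReal 1).integrable le_rfl
  rw [← h, hp.map_eq, integral_sub hi (integrable_const _)]
  simp

theorem integral_coord_sub_sq (θ : ι → ℝ) (k : ι) :
    ∫ p, (p.1 k - θ k) ^ 2 ∂(seqLaw v ρ θ) = v := by
  have hp := measurePreserving_coord (ρ := ρ) (v := v) θ k
  have h := integral_map (μ := seqLaw v ρ θ) hp.measurable.aemeasurable
    (f := fun x : ℝ ↦ (x - θ k) ^ 2) (by fun_prop)
  rw [← h, hp.map_eq]
  have h2 := variance_id_gaussianReal (μ := θ k) (v := v)
  rw [variance_eq_integral (by fun_prop)] at h2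
  simpa using h2

theorem lintegral_comb_sub_sq [DecidableEq ι] (hφm : ∀ k, Measurable (φ k))
    (hφ : ∀ k, MemLp (φ k) 2 unitVol)
    (horth : ∀ j k, ∫ x, φ j x * φ k x ∂unitVol = if j = k then 1 else 0) (θ : ι → ℝ) :
    ∫⁻ p, ‖comb φ (p.1.1 - θ) p.2‖ₑ ^ 2 ∂((seqLaw v ρ θ).prod unitVol)
      = ENNReal.ofReal (Fintype.card ι * v) := by
  have hmeas : Measurable fun p : ((ι → ℝ) × E') × ℝ ↦ comb φ (p.1.1 - θ) p.2 := by
    simp only [comb, Pi.sub_apply]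
    fun_prop
  rw [lintegral_prod _ (hmeas.enorm.pow_const 2).aemeasurable]
  simp only [lintegral_enorm_sq_eq_ofReal (memLp_comb hφ _), integral_comb_sq hφ horth]
  have hi (k : ι) : Integrable (fun p : (ι → ℝ) × E' ↦ (p.1 k - θ k) ^ 2) (seqLaw v ρ θ) :=
    (memLp_coord_sub θ k).integrable_sq
  simp only [Pi.sub_apply]
  rw [← ofReal_integral_eq_lintegral_ofReal (integrable_finsetSum _ fun k _ ↦ hi k)
    (.of_forall fun p ↦ Finset.sum_nonneg fun _ _ ↦ sq_nonneg _),
    integral_finsetSum _ fun k _ ↦ hi k]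
  simp [integral_coord_sub_sq]

theorem integral_comb_sub (θ : ι → ℝ) (x : ℝ) :
    ∫ p, comb φ (p.1 - θ) x ∂(seqLaw v ρ θ) = 0 := by
  simp only [comb, Pi.sub_apply]
  rw [integral_finsetSum _ fun k _ ↦
    ((memLp_coord_sub θ k).integrable (by norm_num)).mul_const _]
  simp [integral_mul_const, integral_coord_sub]

theorem seqLaw_prod_eq_withDensity (hv : v ≠ 0) (θ : ι → ℝ) :
    (seqLaw v ρ θ).prod unitVol = (((volume : Measure (ι → ℝ)).prod ρ).prod unitVol).withDensity
      fun d ↦ ENNReal.ofReal (gaussDensity v θ d.1.1) := by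
  have hc : Measurable fun y : ι → ℝ ↦ gaussDensity v θ y :=
    ((continuous_gaussDensity v).comp (Continuous.prodMk_right θ)).measurable
  have hfin : IsFiniteMeasure
      (volume.withDensity fun y : ι → ℝ ↦ ENNReal.ofReal (gaussDensity v θ y)) := by
    rw [← pi_gaussianReal_eq_withDensity hv θ]; infer_instance
  have hfin2 : IsFiniteMeasure (((volume : Measure (ι → ℝ)).prod ρ).withDensity
      fun p ↦ ENNReal.ofReal (gaussDensity v θ p.1)) := by
    rw [← prod_withDensity_left (f := fun y ↦ ENNReal.ofReal (gaussDensity v θ y)) (by fun_prop)]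
    infer_instance
  rw [seqLaw, pi_gaussianReal_eq_withDensity hv, prod_withDensity_left (by fun_prop),
    prod_withDensity_left (by fun_prop)]

theorem integral_density_mul (hv : v ≠ 0) (θ : ι → ℝ) (c : ℝ) (g : ((ι → ℝ) × E') × ℝ → ℝ) :
    ∫ d, c * (gaussDensity v θ d.1.1 * g d) ∂(((volume : Measure (ι → ℝ)).prod ρ).prod unitVol)
      = c * ∫ d, g d ∂((seqLaw v ρ θ).prod unitVol) := by
  have hc : Measurable fun y : ι → ℝ ↦ gaussDensity v θ y :=
    ((continuous_gaussDensity v).comp (Continuous.prodMk_right θ)).measurable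
  rw [seqLaw_prod_eq_withDensity hv, integral_const_mul,
    integral_withDensity_eq_integral_toReal_smul (by fun_prop) (.of_forall fun _ ↦ by simp)]
  simp [ENNReal.toReal_ofReal (gaussDensity_nonneg v θ _)]

theorem lintegral_density_mul (hv : v ≠ 0) (θ : ι → ℝ) (c : ℝ)
    {g : ((ι → ℝ) × E') × ℝ → ℝ} (hg : Measurable g) :
    ∫⁻ d, ‖c * (gaussDensity v θ d.1.1 * g d)‖ₑ
        ∂(((volume : Measure (ι → ℝ)).prod ρ).prod unitVol)
      = ‖c‖ₑ * ∫⁻ d, ‖g d‖ₑ ∂((seqLaw v ρ θ).prod unitVol) := by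
  have hc : Measurable fun y : ι → ℝ ↦ gaussDensity v θ y :=
    ((continuous_gaussDensity v).comp (Continuous.prodMk_right θ)).measurable
  rw [seqLaw_prod_eq_withDensity hv, lintegral_withDensity_eq_lintegral_mul _ (by fun_prop)
    (by fun_prop), ← lintegral_const_mul' _ _ (by simp)]
  refine lintegral_congr fun d ↦ ?_
  rw [enorm_mul, enorm_mul, Real.enorm_of_nonneg (gaussDensity_nonneg v θ _)]
  rfl

theorem measurable_gaussDensity :
    Measurable fun q : (ι → ℝ) × (ι → ℝ) ↦ gaussDensity v q.1 q.2 :=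
  (continuous_gaussDensity v).measurable

theorem measurable_gaussDensity_comp {α : Type*} [MeasurableSpace α] {f g : α → ι → ℝ}
    (hf : Measurable f) (hg : Measurable g) : Measurable fun x ↦ gaussDensity v (f x) (g x) := by
  have h := measurable_gaussDensity (ι := ι) (v := v)
  have h2 := h.comp (hf.prodMk hg)
  exact h2

/-- Tonelli, with the cutoff κ integrable and the inner L¹ norms uniformly bounded. The bound is
asked only where κ ≠ 0, because bias and variance are controlled only on the ball. This justifies
Fubini in the score identity. -/
theorem integrable_density_mul (hv : v ≠ 0) {κ : (ι → ℝ) → ℝ} (hκ : Continuous κ)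
    (hκc : HasCompactSupport κ) {g : (ι → ℝ) × (((ι → ℝ) × E') × ℝ) → ℝ} (hg : Measurable g)
    {C : ℝ≥0∞} (hC : C ≠ ⊤)
    (h : ∀ θ, κ θ ≠ 0 → ∫⁻ d, ‖g (θ, d)‖ₑ ∂((seqLaw v ρ θ).prod unitVol) ≤ C) :
    Integrable (fun p : (ι → ℝ) × (((ι → ℝ) × E') × ℝ) ↦
      κ p.1 * (gaussDensity v p.1 p.2.1.1 * g p))
      (volume.prod (((volume : Measure (ι → ℝ)).prod ρ).prod unitVol)) := by
  have hm : Measurable fun p : (ι → ℝ) × (((ι → ℝ) × E') × ℝ) ↦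
      κ p.1 * (gaussDensity v p.1 p.2.1.1 * g p) := by
    have h1 := hκ.measurable
    have h2 : Measurable fun p : (ι → ℝ) × (((ι → ℝ) × E') × ℝ) ↦ gaussDensity v p.1 p.2.1.1 :=
      measurable_gaussDensity_comp measurable_fst (by fun_prop)
    exact (h1.comp measurable_fst).mul (h2.mul hg)
  refine ⟨hm.aestronglyMeasurable, ?_⟩
  rw [HasFiniteIntegral, lintegral_prod _ hm.enorm.aemeasurable]
  calc _ ≤ ∫⁻ θ, ‖κ θ‖ₑ * C := by
        refine lintegral_mono fun θ ↦ ?_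
        rw [lintegral_density_mul hv θ (κ θ) (g := fun d ↦ g (θ, d)) (by fun_prop)]
        by_cases hθ : κ θ = 0
        · simp [hθ]
        · gcongr
          exact h θ hθ
    _ = (∫⁻ θ, ‖κ θ‖ₑ) * C := lintegral_mul_const' _ _ hC
    _ < ⊤ := ENNReal.mul_lt_top (hκ.integrable_of_hasCompactSupport hκc).2 hC.lt_top

/-- If, in the sequence model, the integrated squared bias is at most `B` on a ball with squared
radius `b > 4 B`, then the integrated variance cannot be below `card ι * v / 4` everywhere on
that ball. -/
theorem card_mul_le_of_iVar_le [DecidableEq ι] (hv : v ≠ 0) (hφm : ∀ k, Measurable (φ k))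
    (hφ : ∀ k, MemLp (φ k) 2 unitVol)
    (horth : ∀ j k, ∫ x, φ j x * φ k x ∂unitVol = if j = k then 1 else 0)
    {fhat : (ι → ℝ) × E' → ℝ → ℝ} (hm : Measurable (Function.uncurry fhat)) {b B V : ℝ}
    (hB : 0 ≤ B) (hBb : 4 * B < b) (hV0 : 0 ≤ V)
    (hbias : ∀ θ : ι → ℝ, ∑ k, θ k ^ 2 ≤ b →
      iBiasSq (seqLaw v ρ θ) fhat (comb φ θ) ≤ ENNReal.ofReal B)
    (hvar : ∀ θ : ι → ℝ, ∑ k, θ k ^ 2 ≤ b → iVar (seqLaw v ρ θ) fhat ≤ ENNReal.ofReal V) :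
    Fintype.card ι * v / 4 ≤ V := by
  have hv0 : (0 : ℝ) < v := NNReal.coe_pos.2 (pos_iff_ne_zero.2 hv)
  set π : (ι → ℝ) → ℝ := radialPrior (4 * B) b with hπ
  set w : (ι → ℝ) → ℝ := radialWeight (4 * B) b with hw
  have hπs (θ : ι → ℝ) (h : π θ ≠ 0) : ∑ k, θ k ^ 2 ≤ b := by
    by_contra hh
    exact h (radialPrior_eq_zero hBb (not_le.1 hh).le)
  have hws (θ : ι → ℝ) (h : w θ ≠ 0) : ∑ k, θ k ^ 2 ≤ b := by
    by_contra hh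
    exact h (radialWeight_eq_zero hBb (not_le.1 hh).le)
  have hws2 (θ : ι → ℝ) (h : w θ ≠ 0) : 4 * B ≤ ∑ k, θ k ^ 2 := by
    by_contra hh
    exact h (radialWeight_eq_zero_of_lt hBb (not_le.1 hh))
  have hbt (θ : ι → ℝ) (h : ∑ k, θ k ^ 2 ≤ b) :
      iBiasSq (seqLaw v ρ θ) fhat (comb φ θ) ≠ ⊤ :=
    ne_top_of_le_ne_top ENNReal.ofReal_ne_top (hbias θ h)
  have hvt (θ : ι → ℝ) (h : ∑ k, θ k ^ 2 ≤ b) : iVar (seqLaw v ρ θ) fhat ≠ ⊤ :=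
    ne_top_of_le_ne_top ENNReal.ofReal_ne_top (hvar θ h)
  have hfsq (θ : ι → ℝ) : ∫⁻ x, ‖comb φ θ x‖ₑ ^ 2 ∂unitVol = ENNReal.ofReal (∑ k, θ k ^ 2) := by
    rw [lintegral_enorm_sq_eq_ofReal (memLp_comb hφ _), integral_comb_sq hφ horth]
  set C : ℝ≥0∞ := 2 * ENNReal.ofReal V + 2 * (2 * ENNReal.ofReal B + 2 * ENNReal.ofReal b) with hC
  have hu2 (θ : ι → ℝ) (h : ∑ k, θ k ^ 2 ≤ b) :
      ∫⁻ p, ‖fhat p.1 p.2‖ₑ ^ 2 ∂((seqLaw v ρ θ).prod unitVol) ≤ C := by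
    refine (lintegral_fhat_sq_le hm
      (memLp_comb hφ θ).aestronglyMeasurable.aemeasurable).trans ?_
    rw [hfsq, hC]
    gcongr
    · exact hvar θ h
    · exact hbias θ h
  have hmh : Measurable fun q : (ι → ℝ) × (((ι → ℝ) × E') × ℝ) ↦
      comb φ (q.2.1.1 - q.1) q.2.2 := by
    simp only [comb, Pi.sub_apply]
    fun_prop
  have hmf : Measurable fun q : (ι → ℝ) × (((ι → ℝ) × E') × ℝ) ↦ comb φ q.1 q.2.2 := by
    simp only [comb]
    fun_prop
  have hmh' (θ : ι → ℝ) : Measurable fun d : ((ι → ℝ) × E') × ℝ ↦ comb φ (d.1.1 - θ) d.2 :=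
    hmh.comp (measurable_const.prodMk measurable_id)
  have hmf' (θ : ι → ℝ) : Measurable (comb φ θ) := by
    unfold comb
    fun_prop
  -- The product is dominated by the sum of the two squares, with expectations at most C and mv.
  have hint1 := integrable_density_mul (ρ := ρ) hv (continuous_radialPrior (a := 4 * B) (b := b))
    (hasCompactSupport_radialPrior hBb)
    (g := fun q ↦ fhat q.2.1 q.2.2 * comb φ (q.2.1.1 - q.1) q.2.2) (by fun_prop)
    (C := C + ENNReal.ofReal (Fintype.card ι * v)) (by finiteness) (fun θ hθ ↦ by
      refine (lintegral_mono fun d ↦ enorm_mul_le_add_sq _ _).trans ?_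
      rw [lintegral_add_right _ ((hmh' θ).enorm.pow_const 2), lintegral_comb_sub_sq hφm hφ horth]
      gcongr
      exact hu2 θ (hπs θ hθ))
  have hint2 := integrable_density_mul (ρ := ρ) hv (continuous_radialWeight (a := 4 * B) (b := b))
    (hasCompactSupport_radialWeight hBb)
    (g := fun q ↦ fhat q.2.1 q.2.2 * comb φ q.1 q.2.2) (by fun_prop)
    (C := C + ENNReal.ofReal b) (by finiteness) (fun θ hθ ↦ by
      refine (lintegral_mono fun d ↦ enorm_mul_le_add_sq _ _).trans ?_
      have hs : Measurable fun d : ((ι → ℝ) × E') × ℝ ↦ ‖comb φ θ d.2‖ₑ ^ 2 :=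
        ((hmf' θ).comp measurable_snd).enorm.pow_const 2
      rw [lintegral_add_right _ hs]
      gcongr
      · exact hu2 θ (hws θ hθ)
      · rw [lintegral_prod _ hs.aemeasurable]
        simp only [hfsq, lintegral_const, measure_univ, mul_one]
        exact ENNReal.ofReal_le_ofReal (hws θ hθ))
  -- Integrate over θ first, apply the score identity for each fixed (data, x), and then undo
  -- Fubini.
  have hswap : ∫ q, π q.1 * (gaussDensity v q.1 q.2.1.1 *
        (fhat q.2.1 q.2.2 * comb φ (q.2.1.1 - q.1) q.2.2))
        ∂(volume.prod (((volume : Measure (ι → ℝ)).prod ρ).prod unitVol))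
      = v * ∫ q, w q.1 * (gaussDensity v q.1 q.2.1.1 *
        (fhat q.2.1 q.2.2 * comb φ q.1 q.2.2))
        ∂(volume.prod (((volume : Measure (ι → ℝ)).prod ρ).prod unitVol)) := by
    rw [integral_prod_symm _ hint1, integral_prod_symm _ hint2, ← integral_const_mul]
    refine integral_congr_ae (.of_forall fun d ↦ ?_)
    have h1 := integral_radialPrior_mul_gaussDensity hBb (v := v) d.1.1 fun k ↦ φ k d.2
    have e1 (θ : ι → ℝ) : π θ * (gaussDensity v θ d.1.1 *
        (fhat d.1 d.2 * comb φ (d.1.1 - θ) d.2)) = (v * fhat d.1 d.2) *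
        (π θ * (gaussDensity v θ d.1.1 * ((∑ k, (d.1.1 k - θ k) * φ k d.2) / v))) := by
      simp only [comb, Pi.sub_apply]
      field_simp
    have e2 (θ : ι → ℝ) : w θ * (gaussDensity v θ d.1.1 * (fhat d.1 d.2 * comb φ θ d.2))
        = fhat d.1 d.2 * (w θ * (∑ k, θ k * φ k d.2) * gaussDensity v θ d.1.1) := by
      simp only [comb]
      ring
    simp only [← hπ, ← hw] at h1 ⊢
    simp only [e1, e2, integral_const_mul, h1]
    ring
  rw [integral_prod _ hint1, integral_prod _ hint2] at hswap
  have hI1 := hint1.integral_prod_left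
  have hI2 := hint2.integral_prod_left
  simp only [← hπ, ← hw] at hI1 hI2
  simp only [integral_density_mul hv] at hswap hI1 hI2
  have hπi : Integrable π :=
    continuous_radialPrior.integrable_of_hasCompactSupport (hasCompactSupport_radialPrior hBb)
  have hwi : Integrable fun θ : ι → ℝ ↦ w θ * ∑ k, θ k ^ 2 := by
    have := continuous_radialWeight (ι := ι) (a := 4 * B) (b := b)
    exact Continuous.integrable_of_hasCompactSupport (by fun_prop)
      (hasCompactSupport_radialWeight hBb).mul_right
  have hupper : ∫ θ, π θ * ∫ d, fhat d.1 d.2 * comb φ (d.1.1 - θ) d.2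
        ∂((seqLaw v ρ θ).prod unitVol)
      ≤ ∫ θ, π θ * (V + Fintype.card ι * v / 4) := by
    refine integral_mono hI1 (hπi.mul_const _) fun θ ↦ ?_
    by_cases hθ : π θ = 0
    · simp [hθ]
    refine mul_le_mul_of_nonneg_left ?_ (radialPrior_nonneg θ)
    have hh : MemLp (fun d : ((ι → ℝ) × E') × ℝ ↦ comb φ (d.1.1 - θ) d.2) 2
        ((seqLaw v ρ θ).prod unitVol) := by
      rw [memLp_two_iff_lintegral (hmh' θ).aestronglyMeasurable,
        lintegral_comb_sub_sq hφm hφ horth]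
      finiteness
    refine (integral_fhat_mul_le hm (memLp_comb hφ θ) (hbt θ (hπs θ hθ)) (hvt θ (hπs θ hθ)) hh
      (fun x ↦ integral_comb_sub θ x)).trans ?_
    rw [integral_sq_eq_toReal hh, lintegral_comb_sub_sq hφm hφ horth,
      ENNReal.toReal_ofReal (by positivity)]
    gcongr
    exact ENNReal.toReal_le_of_le_ofReal hV0 (hvar θ (hπs θ hθ))
  have hlower : ∫ θ, w θ * (∑ k, θ k ^ 2) * (1 / 2) ≤ ∫ θ, w θ * ∫ d, fhat d.1 d.2 * comb φ θ d.2
        ∂((seqLaw v ρ θ).prod unitVol) := by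
    refine integral_mono (hwi.mul_const _) hI2 fun θ ↦ ?_
    by_cases hθ : w θ = 0
    · simp [hθ]
    simp only [mul_assoc]
    refine mul_le_mul_of_nonneg_left ?_ (radialWeight_nonneg hBb θ)
    have h1 := le_integral_fhat_mul hm (memLp_comb hφ θ) (hvt θ (hws θ hθ))
      (hbias θ (hws θ hθ)) (by rw [integral_comb_sq hφ horth]; exact hws2 θ hθ)
    rw [integral_comb_sq hφ horth] at h1
    linarith
  rw [integral_mul_const] at hupper hlower
  rw [integral_radialWeight_mul_sum_sq hBb] at hlower
  have hpos := integral_radialPrior_pos (ι := ι) (mul_nonneg zero_le_four hB) hBb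
  rw [← hπ] at hpos hlower
  -- This reads (mv/2) ∫ π ≤ (V + mv/4) ∫ π; the positive mass of π then cancels.
  have hfin : v * ((Fintype.card ι * ∫ θ, π θ) * (1 / 2))
      ≤ (∫ θ, π θ) * (V + Fintype.card ι * v / 4) := by
    refine le_trans ?_ hupper
    rw [hswap]
    exact mul_le_mul_of_nonneg_left hlower hv0.le
  have : (∫ θ, π θ) * (Fintype.card ι * v / 4) ≤ (∫ θ, π θ) * V := by linarith
  exact le_of_mul_le_mul_left this hpos

end SequenceModel

/-! ### Rescaled copies of a kernel in the Sobolev ball -/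

section Sobolev

theorem iteratedDeriv_eq_zero_of_notMem_tsupport {φ : ℝ → ℝ} {k : ℕ} {x : ℝ}
    (hx : x ∉ tsupport φ) : iteratedDeriv k φ x = 0 := by
  have h : iteratedFDeriv ℝ k φ x = 0 :=
    image_eq_zero_of_notMem_tsupport fun h ↦ hx (tsupport_iteratedFDeriv_subset k h)
  rw [iteratedDeriv_eq_iteratedFDeriv, h]
  rfl

theorem memLp_iteratedDeriv {φ : ℝ → ℝ} (hφ : ContDiff ℝ ∞ φ) (hc : HasCompactSupport φ) (k : ℕ)
    (μ : Measure ℝ) [IsFiniteMeasureOnCompacts μ] : MemLp (iteratedDeriv k φ) 2 μ := by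
  refine Continuous.memLp_of_hasCompactSupport ?_ ?_
  · exact hφ.continuous_iteratedDeriv k (by exact_mod_cast le_top)
  · exact hc.mono' fun x hx ↦ by
      by_contra h
      exact hx (iteratedDeriv_eq_zero_of_notMem_tsupport h)

theorem IsWeakDeriv.congr {U : Set ℝ} {k : ℕ} {f g f' g' : ℝ → ℝ} (h : IsWeakDeriv U k f g)
    (hf : f =ᵐ[volume] f') (hg : g =ᵐ[volume] g') : IsWeakDeriv U k f' g' := by
  refine ⟨fun x hx ↦ ?_, fun x hx ↦ ?_, fun φ h1 h2 h3 ↦ ?_⟩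
  · obtain ⟨s, hs, hi⟩ := h.1 x hx
    exact ⟨s, hs, hi.congr (ae_restrict_of_ae hf)⟩
  · obtain ⟨s, hs, hi⟩ := h.2.1 x hx
    exact ⟨s, hs, hi.congr (ae_restrict_of_ae hg)⟩
  · have e1 : ∫ x in U, f x * iteratedDeriv k φ x = ∫ x in U, f' x * iteratedDeriv k φ x := by
      refine integral_congr_ae ?_
      filter_upwards [ae_restrict_of_ae hf] with x hx
      rw [hx]
    have e2 : ∫ x in U, g x * φ x = ∫ x in U, g' x * φ x := by
      refine integral_congr_ae ?_
      filter_upwards [ae_restrict_of_ae hg] with x hx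
      rw [hx]
    rw [← e1, ← e2, h.2.2 φ h1 h2 h3]

/-- Weak differentiation is local: testing with functions supported off F annihilates f, hence g. -/
theorem IsWeakDeriv.ae_eq_zero {k : ℕ} {f g : ℝ → ℝ} (h : IsWeakDeriv univ k f g) {F : Set ℝ}
    (hF : IsClosed F) (hf : Function.support f ⊆ F) : ∀ᵐ x, x ∈ Fᶜ → g x = 0 := by
  refine hF.isOpen_compl.ae_eq_zero_of_integral_contDiff_smul_eq_zero
    (h.2.1.mono_set (subset_univ _)) fun φ h1 h2 h3 ↦ ?_
  have h4 := h.2.2 φ h1 h2 (subset_univ _)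
  have h5 (x : ℝ) : f x * iteratedDeriv k φ x = 0 := by
    by_cases hx : f x = 0
    · rw [hx, zero_mul]
    · rw [iteratedDeriv_eq_zero_of_notMem_tsupport fun hh ↦ h3 hh (hf hx), mul_zero]
  simp only [h5, integral_zero, Measure.restrict_univ] at h4
  have h6 := (mul_eq_zero.1 h4.symm).resolve_left (by simp)
  simpa [mul_comm] using h6

/-- Changing values on a null set, endpoints included, yields an open support, so that rescaled
copies are pointwise disjoint and vanish outside the open unit interval. -/
theorem exists_measurable_support_Ioo {h : ℝ → ℝ} {a b : ℝ} (hm : AEStronglyMeasurable h volume)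
    (hs : ∀ᵐ x, x ∈ (Icc a b)ᶜ → h x = 0) :
    ∃ h', Measurable h' ∧ Function.support h' ⊆ Ioo a b ∧ h =ᵐ[volume] h' := by
  refine ⟨(Ioo a b).indicator (hm.mk h), hm.stronglyMeasurable_mk.measurable.indicator
    measurableSet_Ioo, support_indicator_subset, ?_⟩
  have h1 : ∀ᵐ x : ℝ, x ≠ a := by simp [ae_iff]
  have h2 : ∀ᵐ x : ℝ, x ≠ b := by simp [ae_iff]
  filter_upwards [h1, h2, hm.ae_eq_mk, hs] with x h1 h2 h3 h4
  by_cases hx : x ∈ Ioo a b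
  · rw [indicator_of_mem hx, h3]
  · rw [indicator_of_notMem hx]
    exact h4 fun hh ↦ hx ⟨lt_of_le_of_ne hh.1 h1.symm, lt_of_le_of_ne hh.2 h2⟩

/-- The strict inequality gives a competitor of Sobolev norm below R/2, so attainment of the infimum
is not needed. -/
theorem exists_kernel {k : ℕ} {R : ℝ} (hR : 2 * Gam k < ENNReal.ofReal R) :
    ∃ K g : ℝ → ℝ, Measurable K ∧ Measurable g ∧
      Function.support K ⊆ Ioo (-(1 / 2) : ℝ) (1 / 2) ∧
      Function.support g ⊆ Ioo (-(1 / 2) : ℝ) (1 / 2) ∧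
      MemLp K 2 volume ∧ MemLp g 2 volume ∧ ∫ x, K x ^ 2 = 1 ∧ IsWeakDeriv univ k K g ∧
      4 * (1 + ∫ x, g x ^ 2) ≤ R ^ 2 := by
  have hR0 : 0 < R := by
    by_contra h
    rw [ENNReal.ofReal_of_nonpos (not_lt.1 h)] at hR
    exact not_lt_bot hR
  have h1 : Gam k < ENNReal.ofReal (R / 2) := by
    rw [ENNReal.ofReal_div_of_pos zero_lt_two, ENNReal.ofReal_ofNat,
      ENNReal.lt_div_iff_mul_lt (by simp) (by simp), mul_comm]
    exact hR
  simp only [Gam, sobolevNorm, iInf_lt_iff] at h1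
  obtain ⟨K, hK1, hKs, g, hKg, hlt⟩ := h1
  have hKm : AEStronglyMeasurable K volume :=
    (locallyIntegrableOn_univ.1 hKg.1).aestronglyMeasurable
  have hgm : AEStronglyMeasurable g volume :=
    (locallyIntegrableOn_univ.1 hKg.2.1).aestronglyMeasurable
  obtain ⟨K', hK'm, hK's, hKK'⟩ := exists_measurable_support_Ioo (a := -(1 / 2)) (b := 1 / 2) hKm
    (.of_forall fun x hx ↦ by
      by_contra h
      exact hx (hKs h))
  obtain ⟨g', hg'm, hg's, hgg'⟩ := exists_measurable_support_Ioo (a := -(1 / 2)) (b := 1 / 2) hgm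
    (hKg.ae_eq_zero isClosed_Icc hKs)
  rw [Measure.restrict_univ, eLpNorm_congr_ae hKK', eLpNorm_congr_ae hgg'] at hlt
  rw [eLpNorm_congr_ae hKK'] at hK1
  have hlt2 : eLpNorm K' 2 volume ^ 2 + eLpNorm g' 2 volume ^ 2 ≤ ENNReal.ofReal (R ^ 2 / 4) := by
    have h2 := ENNReal.rpow_le_rpow hlt.le (z := 2) zero_le_two
    rw [← ENNReal.rpow_mul] at h2
    norm_num at h2
    refine h2.trans (le_of_eq ?_)
    rw [← ENNReal.ofReal_pow (by positivity)]
    congr 1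
    ring
  have hKL : MemLp K' 2 volume := ⟨hK'm.aestronglyMeasurable, by rw [hK1]; simp⟩
  have hgL : MemLp g' 2 volume := by
    rw [memLp_two_iff_lintegral hg'm.aestronglyMeasurable, lintegral_enorm_sq_eq_eLpNorm_sq]
    exact ne_top_of_le_ne_top ENNReal.ofReal_ne_top (le_add_self.trans hlt2)
  have hK2 : ∫ x, K' x ^ 2 = 1 := by
    rw [integral_sq_eq_toReal hKL, lintegral_enorm_sq_eq_eLpNorm_sq, hK1]
    simp
  refine ⟨K', g', hK'm, hg'm, hK's, hg's, hKL, hgL, hK2, hKg.congr hKK' hgg', ?_⟩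
  rw [← lintegral_enorm_sq_eq_eLpNorm_sq, ← lintegral_enorm_sq_eq_eLpNorm_sq,
    lintegral_enorm_sq_eq_ofReal hKL, lintegral_enorm_sq_eq_ofReal hgL, hK2,
    ← ENNReal.ofReal_add zero_le_one (integral_nonneg fun _ ↦ sq_nonneg _),
    ENNReal.ofReal_le_ofReal_iff (by positivity)] at hlt2
  linarith

/-- The `k`-th of `m` rescaled copies of the function `h`. -/
noncomputable def rescale (m : ℕ) (h : ℝ → ℝ) (k : Fin m) : ℝ → ℝ :=
  fun x ↦ √m * h (m * x - (k + 1 / 2))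

variable {m : ℕ} {h : ℝ → ℝ}

theorem measurable_rescale (hm : Measurable h) (k : Fin m) : Measurable (rescale m h k) := by
  unfold rescale
  fun_prop

theorem support_rescale (hs : Function.support h ⊆ Ioo (-(1 / 2) : ℝ) (1 / 2)) (k : Fin m)
    {x : ℝ} (hx : rescale m h k x ≠ 0) : (k : ℝ) < m * x ∧ m * x < k + 1 := by
  have h1 : m * x - (k + 1 / 2) ∈ Function.support h := fun h0 ↦ hx (by rw [rescale, h0, mul_zero])
  have h2 := hs h1
  constructor <;> linarith [h2.1, h2.2]

theorem support_rescale_subset (hs : Function.support h ⊆ Ioo (-(1 / 2) : ℝ) (1 / 2))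
    (k : Fin m) : Function.support (rescale m h k) ⊆ Ioo 0 1 := by
  intro x hx
  obtain ⟨h1, h2⟩ := support_rescale hs k hx
  have hm0 : (0 : ℝ) < m := by exact_mod_cast k.pos
  have hk : (k : ℝ) + 1 ≤ m := by exact_mod_cast k.2
  have hk0 : (0 : ℝ) ≤ k := Nat.cast_nonneg _
  constructor
  · by_contra hx0
    nlinarith
  · by_contra hx0
    nlinarith

theorem integral_comp_mul_sub (F : ℝ → ℝ) (hm : 0 < m) (c : ℝ) :
    ∫ x, F (m * x - c) = (m : ℝ)⁻¹ * ∫ x, F x := by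
  have h1 := Measure.integral_comp_mul_left (fun x ↦ F (x - c)) (m : ℝ)
  rw [h1, integral_sub_right_eq_self, abs_of_nonneg (by positivity), smul_eq_mul]

theorem memLp_rescale (hm : Measurable h) (hL : MemLp h 2 volume) (k : Fin m) :
    MemLp (rescale m h k) 2 volume := by
  rw [memLp_two_iff_integrable_sq (measurable_rescale hm k).aestronglyMeasurable]
  have hm0 : (m : ℝ) ≠ 0 := by exact_mod_cast k.pos.ne'
  have h1 := ((hL.integrable_sq.comp_sub_right ((k : ℝ) + 1 / 2)).comp_mul_left' hm0).const_mul
    ((√m) ^ 2)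
  refine h1.congr (.of_forall fun x ↦ ?_)
  simp [rescale, mul_pow]

theorem integral_rescale_mul (hs : Function.support h ⊆ Ioo (-(1 / 2) : ℝ) (1 / 2))
    (j k : Fin m) :
    ∫ x, rescale m h j x * rescale m h k x ∂unitVol = if j = k then ∫ x, h x ^ 2 else 0 := by
  have hm0 : (0 : ℝ) < m := by exact_mod_cast k.pos
  by_cases hjk : j = k
  · subst hjk
    rw [if_pos rfl, setIntegral_eq_integral_of_forall_compl_eq_zero]
    · have h1 (x : ℝ) : rescale m h j x * rescale m h j x = m * h (m * x - (j + 1 / 2)) ^ 2 := by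
        rw [rescale, mul_mul_mul_comm, Real.mul_self_sqrt hm0.le, pow_two]
      simp only [h1]
      rw [integral_const_mul, integral_comp_mul_sub (fun x ↦ h x ^ 2) j.pos,
        mul_inv_cancel_left₀ hm0.ne']
    · intro x hx
      by_contra hh
      exact hx (Ioo_subset_Icc_self (support_rescale_subset hs j (left_ne_zero_of_mul hh)))
  · rw [if_neg hjk]
    refine integral_eq_zero_of_ae (.of_forall fun x ↦ ?_)
    by_contra hh
    obtain ⟨h1, h2⟩ := support_rescale hs j (left_ne_zero_of_mul hh)
    obtain ⟨h3, h4⟩ := support_rescale hs k (right_ne_zero_of_mul hh)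
    have h5 : (j : ℝ) < k + 1 := h1.trans h4
    have h6 : (k : ℝ) < j + 1 := h3.trans h2
    norm_cast at h5 h6
    exact hjk (Fin.ext (by omega))

/-- Transport the test function to the scale of the kernel by the inverse affine map; each
derivative contributes a factor m. -/
theorem integral_rescale_mul_iteratedDeriv {K g : ℝ → ℝ} {β : ℕ} (hKg : IsWeakDeriv univ β K g)
    (k : Fin m) {φ : ℝ → ℝ} (h1 : ContDiff ℝ ∞ φ) (h2 : HasCompactSupport φ) :
    ∫ x, rescale m K k x * iteratedDeriv β φ x
      = (-1) ^ β * ∫ x, (m ^ β * rescale m g k x) * φ x := by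
  have hm0 : (m : ℝ) ≠ 0 := by exact_mod_cast k.pos.ne'
  set c : ℝ := k + 1 / 2 with hc
  set η : ℝ → ℝ := fun y ↦ φ ((m : ℝ)⁻¹ * y + (m : ℝ)⁻¹ * c) with hη
  have hinv (x : ℝ) : (m : ℝ)⁻¹ * (m * x - c) + (m : ℝ)⁻¹ * c = x := by
    field_simp
    ring
  have hη1 : ContDiff ℝ ∞ η := by fun_prop
  have hη2 : HasCompactSupport η := by
    have h3 : η = φ ∘ ((Homeomorph.mulLeft₀ (m : ℝ)⁻¹ (inv_ne_zero hm0)).trans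
        (Homeomorph.addRight ((m : ℝ)⁻¹ * c))) := by
      ext y
      simp [hη]
    rw [h3]
    exact h2.comp_homeomorph _
  have hηd (x : ℝ) : iteratedDeriv β φ x = m ^ β * iteratedDeriv β η (m * x - c) := by
    have h3 : ContDiff ℝ β (fun z ↦ φ (z + (m : ℝ)⁻¹ * c)) := by
      have : ContDiff ℝ β φ := h1.of_le (by exact_mod_cast le_top)
      fun_prop
    have h4 := iteratedDeriv_comp_const_mul h3 (m : ℝ)⁻¹
    have h5 := iteratedDeriv_comp_add_const β φ ((m : ℝ)⁻¹ * c)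
    rw [hη, h4]
    simp only [h5, hinv]
    rw [← mul_assoc, ← mul_pow, mul_inv_cancel₀ hm0, one_pow, one_mul]
  have h6 := hKg.2.2 η hη1 hη2 (subset_univ _)
  rw [Measure.restrict_univ] at h6
  have e1 (x : ℝ) : rescale m K k x * iteratedDeriv β φ x
      = (√m * m ^ β) * (fun y ↦ K y * iteratedDeriv β η y) (m * x - c) := by
    rw [hηd, rescale]
    ring
  have e2 (x : ℝ) : (m ^ β * rescale m g k x) * φ x
      = (√m * m ^ β) * (fun y ↦ g y * η y) (m * x - c) := by
    simp only [hη, hinv]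
    rw [rescale]
    ring
  simp only [e1, e2]
  rw [integral_const_mul, integral_const_mul,
    integral_comp_mul_sub (fun y ↦ K y * iteratedDeriv β η y) k.pos,
    integral_comp_mul_sub (fun y ↦ g y * η y) k.pos, h6]
  ring

theorem locallyIntegrableOn_of_memLp {f : ℝ → ℝ} (hf : MemLp f 2 unitVol) :
    LocallyIntegrableOn f (Ioo 0 1) := by
  have h1 : IntegrableOn f (Icc 0 1) := hf.integrable (by norm_num)
  exact (h1.mono_set Ioo_subset_Icc_self).locallyIntegrableOn

theorem comb_smul {ι : Type*} [Fintype ι] (φ : ι → ℝ → ℝ) (a : ℝ) (c : ι → ℝ) (x : ℝ) :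
    comb φ (a • c) x = ∑ k, c k * (a * φ k x) :=
  Finset.sum_congr rfl fun k _ ↦ by simp only [Pi.smul_apply, smul_eq_mul]; ring

theorem isWeakDeriv_comb_rescale {K g : ℝ → ℝ} {β : ℕ} (hKg : IsWeakDeriv univ β K g)
    (hKs : Function.support K ⊆ Ioo (-(1 / 2) : ℝ) (1 / 2))
    (hgs : Function.support g ⊆ Ioo (-(1 / 2) : ℝ) (1 / 2))
    (hK : ∀ k : Fin m, MemLp (rescale m K k) 2 unitVol)
    (hg : ∀ k : Fin m, MemLp (rescale m g k) 2 unitVol) (θ : Fin m → ℝ) :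
    IsWeakDeriv (Ioo 0 1) β (comb (rescale m K) θ) (comb (rescale m g) ((m : ℝ) ^ β • θ)) := by
  refine ⟨locallyIntegrableOn_of_memLp (memLp_comb hK _),
    locallyIntegrableOn_of_memLp (memLp_comb hg _), fun φ h1 h2 h3 ↦ ?_⟩
  have hset (F : Fin m → ℝ → ℝ) (hF : ∀ k, Function.support (F k) ⊆ Ioo 0 1) (f : ℝ → ℝ)
      (k : Fin m) : ∫ x in Ioo 0 1, F k x * f x = ∫ x, F k x * f x := by
    refine setIntegral_eq_integral_of_forall_compl_eq_zero fun x hx ↦ ?_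
    by_contra hh
    exact hx (hF k (left_ne_zero_of_mul hh))
  have hres {f : ℝ → ℝ} (hf : MemLp f 2 unitVol) : MemLp f 2 (volume.restrict (Ioo 0 1)) :=
    hf.mono_measure (Measure.restrict_mono Ioo_subset_Icc_self le_rfl)
  have hd := memLp_iteratedDeriv h1 h2 β (volume.restrict (Ioo (0 : ℝ) 1))
  have hφ : MemLp φ 2 (volume.restrict (Ioo (0 : ℝ) 1)) :=
    h1.continuous.memLp_of_hasCompactSupport h2
  have e1 : ∫ x in Ioo 0 1, comb (rescale m K) θ x * iteratedDeriv β φ x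
      = ∑ k, θ k * ∫ x in Ioo 0 1, rescale m K k x * iteratedDeriv β φ x := by
    simp only [comb, Finset.sum_mul, mul_assoc]
    rw [integral_finsetSum _ fun k _ ↦ (integrable_mul_of_memLp (hres (hK k)) hd).const_mul _]
    simp only [integral_const_mul]
  have e2 : ∫ x in Ioo 0 1, comb (rescale m g) ((m : ℝ) ^ β • θ) x * φ x
      = ∑ k, θ k * ∫ x in Ioo 0 1, ((m : ℝ) ^ β * rescale m g k x) * φ x := by
    simp only [comb_smul, Finset.sum_mul]
    rw [integral_finsetSum]
    · simp only [mul_assoc, integral_const_mul]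
    · intro k _
      have h4 := (integrable_mul_of_memLp (hres (hg k)) hφ).const_mul (θ k * (m : ℝ) ^ β)
      refine h4.congr (.of_forall fun x ↦ ?_)
      simp only
      ring
  rw [e1, e2, Finset.mul_sum]
  refine Finset.sum_congr rfl fun k _ ↦ ?_
  rw [hset _ (support_rescale_subset hKs),
    hset (fun k x ↦ (m : ℝ) ^ β * rescale m g k x)
      (fun k x hx ↦ support_rescale_subset hgs k (right_ne_zero_of_mul hx)),
    integral_rescale_mul_iteratedDeriv hKg k h1 h2]
  ring

theorem eLpNorm_Ioo_sq {f : ℝ → ℝ} (hf : MemLp f 2 unitVol) :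
    eLpNorm f 2 (volume.restrict (Ioo 0 1)) ^ 2 = ENNReal.ofReal (∫ x, f x ^ 2 ∂unitVol) := by
  rw [restrict_Ioo_eq_restrict_Icc, ← lintegral_enorm_sq_eq_eLpNorm_sq,
    lintegral_enorm_sq_eq_ofReal hf]

/-- In the Sobolev ball there is, for every `m`, an orthonormal system of `m` functions spanning
a Euclidean ball of squared radius `4 m^{-2β}`. -/
theorem exists_orthonormal_system {β : ℕ} {R : ℝ} (hR : 2 * Gam β < ENNReal.ofReal R) {m : ℕ}
    (hm : 0 < m) :
    ∃ φ : Fin m → ℝ → ℝ, (∀ k, Measurable (φ k)) ∧ (∀ k, MemLp (φ k) 2 unitVol) ∧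
      (∀ j k, ∫ x, φ j x * φ k x ∂unitVol = if j = k then 1 else 0) ∧
      ∀ θ : Fin m → ℝ, ∑ k, θ k ^ 2 ≤ 4 / ((m : ℝ) ^ β) ^ 2 → comb φ θ ∈ sobolevBall β R := by
  obtain ⟨K, g, hKm, hgm, hKs, hgs, hKL, hgL, hK2, hKg, hle⟩ := exists_kernel hR
  have hK (k : Fin m) : MemLp (rescale m K k) 2 unitVol := (memLp_rescale hKm hKL k).restrict _
  have hg (k : Fin m) : MemLp (rescale m g k) 2 unitVol := (memLp_rescale hgm hgL k).restrict _
  have hKo := fun j k ↦ integral_rescale_mul (m := m) hKs j k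
  have hgo := fun j k ↦ integral_rescale_mul (m := m) hgs j k
  rw [hK2] at hKo
  refine ⟨rescale m K, measurable_rescale hKm, hK, hKo, fun θ hθ ↦ ?_⟩
  have hR0 : 0 ≤ R := by
    by_contra h
    rw [ENNReal.ofReal_of_nonpos (not_le.1 h).le] at hR
    exact not_lt_bot hR
  change sobolevNorm (Ioo 0 1) β (comb (rescale m K) θ) ≤ ENNReal.ofReal R
  rw [sobolevNorm]
  refine (iInf₂_le _ (isWeakDeriv_comb_rescale hKg hKs hgs hK hg θ)).trans ?_
  rw [eLpNorm_Ioo_sq (memLp_comb hK _), eLpNorm_Ioo_sq (memLp_comb hg _),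
    integral_comb_sq hK hKo, integral_comb_sq_of_orthogonal hg hgo]
  have hA : 0 ≤ ∫ x, g x ^ 2 := integral_nonneg fun _ ↦ sq_nonneg _
  have hθ0 : 0 ≤ ∑ k, θ k ^ 2 := Finset.sum_nonneg fun _ _ ↦ sq_nonneg _
  have hmp : (1 : ℝ) ≤ ((m : ℝ) ^ β) ^ 2 :=
    one_le_pow₀ (one_le_pow₀ (by exact_mod_cast hm))
  rw [le_div_iff₀ (by positivity)] at hθ
  simp only [Pi.smul_apply, smul_eq_mul, mul_pow, ← Finset.mul_sum]
  rw [← ENNReal.ofReal_add hθ0 (by positivity)]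
  -- Since m^{2β} ∑ θ_k² ≤ 4 and m^{2β} ≥ 1, the left side is at most 4 + 4‖g‖² ≤ R².
  have hb : ∑ k, θ k ^ 2 + (∫ x, g x ^ 2) * (((m : ℝ) ^ β) ^ 2 * ∑ k, θ k ^ 2) ≤ R ^ 2 := by
    nlinarith
  calc _ ≤ ENNReal.ofReal (R ^ 2) ^ (1 / 2 : ℝ) :=
        ENNReal.rpow_le_rpow (ENNReal.ofReal_le_ofReal hb) (by norm_num)
    _ = ENNReal.ofReal R := by
        rw [ENNReal.ofReal_rpow_of_nonneg (by positivity) (by norm_num), ← Real.sqrt_eq_rpow,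
          Real.sqrt_sq hR0]

end Sobolev

/-! ### Lower bounds in the white noise model -/

section RiskMap

variable {E F : Type*} [MeasurableSpace E] [MeasurableSpace F] {Q : Measure E} {T : E → F}
  {fhat : F → ℝ → ℝ}

theorem integral_map_fhat (hT : Measurable T) (hm : Measurable (Function.uncurry fhat)) (x : ℝ) :
    ∫ y, fhat y x ∂(Q.map T) = ∫ y, fhat (T y) x ∂Q := by
  have h1 : Measurable fun y ↦ fhat y x := hm.comp (measurable_id.prodMk measurable_const)
  exact integral_map hT.aemeasurable h1.aestronglyMeasurable

theorem iBiasSq_map (hT : Measurable T) (hm : Measurable (Function.uncurry fhat)) (f : ℝ → ℝ) :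
    iBiasSq (Q.map T) fhat f = iBiasSq Q (fun y ↦ fhat (T y)) f := by
  simp only [iBiasSq, integral_map_fhat hT hm]

theorem iVar_map (hT : Measurable T) (hm : Measurable (Function.uncurry fhat)) :
    iVar (Q.map T) fhat = iVar Q (fun y ↦ fhat (T y)) := by
  refine lintegral_congr fun x ↦ ?_
  have h1 : Measurable fun y ↦ fhat y x := hm.comp (measurable_id.prodMk measurable_const)
  rw [evariance, evariance, lintegral_map (by fun_prop) hT, integral_map_fhat hT hm]

end RiskMap

/-! ### Mean squared error dominates squared bias and variance -/

section Mise

variable {E : Type*} [MeasurableSpace E] {Q : Measure E} [IsProbabilityMeasure Q]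

/-- This is E(X - c)² = Var X + (EX - c)². If the left side is infinite there is nothing to prove,
and otherwise X is square integrable; so the MISE bound needs no integrability assumption on the
estimator. -/
theorem enorm_integral_sub_sq_le_and_evariance_le {X : E → ℝ} (hX : AEStronglyMeasurable X Q)
    (c : ℝ) : ‖(∫ y, X y ∂Q) - c‖ₑ ^ 2 ≤ ∫⁻ y, ‖X y - c‖ₑ ^ 2 ∂Q ∧
      evariance X Q ≤ ∫⁻ y, ‖X y - c‖ₑ ^ 2 ∂Q := by
  by_cases htop : ∫⁻ y, ‖X y - c‖ₑ ^ 2 ∂Q = ⊤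
  · simp [htop]
  have hD : MemLp (fun y ↦ X y - c) 2 Q :=
    (memLp_two_iff_lintegral (hX.sub aestronglyMeasurable_const)).2 htop
  have hXL : MemLp X 2 Q := by
    have h1 := hD.add (memLp_const c)
    refine (memLp_congr_ae (.of_forall fun y ↦ ?_)).1 h1
    simp
  have hXi : Integrable X Q := hXL.integrable (by norm_num)
  have h1 := variance_eq_sub hD
  rw [variance_sub_const hX, integral_sub hXi (integrable_const c)] at h1
  simp only [integral_const, probReal_univ, smul_eq_mul, one_mul, Pi.pow_apply] at h1
  have h2 := variance_nonneg X Q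
  rw [lintegral_enorm_sq_eq_ofReal hD, ← ofReal_variance hXL]
  constructor
  · rw [← ofReal_norm, ← ENNReal.ofReal_pow (norm_nonneg _), Real.norm_eq_abs, sq_abs]
    exact ENNReal.ofReal_le_ofReal (by linarith)
  · exact ENNReal.ofReal_le_ofReal (by nlinarith [sq_nonneg ((∫ y, X y ∂Q) - c)])

theorem iBiasSq_le_mise_and_iVar_le_mise {fhat : E → ℝ → ℝ}
    (hm : Measurable (Function.uncurry fhat)) {f : ℝ → ℝ} (hf : AEMeasurable f unitVol) :
    iBiasSq Q fhat f ≤ mise Q fhat f ∧ iVar Q fhat ≤ mise Q fhat f := by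
  have hu : AEMeasurable (fun p : E × ℝ ↦ ‖fhat p.1 p.2 - f p.2‖ₑ ^ 2) (Q.prod unitVol) :=
    ((hm.aemeasurable.sub hf.comp_snd).enorm.pow_const 2)
  have hsw : mise Q fhat f = ∫⁻ x, ∫⁻ y, ‖fhat y x - f x‖ₑ ^ 2 ∂Q ∂unitVol :=
    lintegral_lintegral_swap hu
  have hX (x : ℝ) : AEStronglyMeasurable (fun y ↦ fhat y x) Q :=
    (hm.comp (measurable_id.prodMk measurable_const)).aestronglyMeasurable
  rw [hsw]
  exact ⟨lintegral_mono fun x ↦ (enorm_integral_sub_sq_le_and_evariance_le (hX x) (f x)).1,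
    lintegral_mono fun x ↦ (enorm_integral_sub_sq_le_and_evariance_le (hX x) (f x)).2⟩

theorem aemeasurable_of_mem_sobolevBall {k : ℕ} {R : ℝ} {f : ℝ → ℝ} (hf : f ∈ sobolevBall k R) :
    AEMeasurable f unitVol := by
  have h1 : sobolevNorm (Ioo 0 1) k f < ⊤ := lt_of_le_of_lt hf ENNReal.ofReal_lt_top
  simp only [sobolevNorm, iInf_lt_iff] at h1
  obtain ⟨g, hg, -⟩ := h1
  have h2 := hg.1.aestronglyMeasurable
  rw [restrict_Ioo_eq_restrict_Icc] at h2
  exact h2.aemeasurable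

end Mise

/-! ### Transfer to the white noise model and choice of the dimension -/

section Model

variable {Ω Z : Type*} [MeasurableSpace Ω] [MeasurableSpace Z] {P : Measure Ω}
  {W : ℝ≥0 → Ω → ℝ} {ν : Measure Z} [IsProbabilityMeasure ν] {n : ℕ}

theorem isProbabilityMeasure_law [IsProbabilityMeasure P] (hWm : ∀ t, Measurable (W t))
    (f : ℝ → ℝ) : IsProbabilityMeasure (law n W P ν f) := by
  have hp : Measurable (path n W f) := by
    refine measurable_pi_lambda _ fun t ↦ ?_
    have := hWm ⟨(t : ℝ), t.2.1⟩
    unfold path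
    fun_prop
  have := Measure.isProbabilityMeasure_map (μ := P) hp.aemeasurable
  unfold law
  infer_instance

theorem orthonormal_toLp {ι : Type*} [Fintype ι] [DecidableEq ι] {φ : ι → ℝ → ℝ}
    (hφ : ∀ k, MemLp (φ k) 2 unitVol)
    (horth : ∀ j k, ∫ x, φ j x * φ k x ∂unitVol = if j = k then 1 else 0) :
    Orthonormal ℝ fun k ↦ (hφ k).toLp := by
  rw [orthonormal_iff_ite]
  intro j k
  rw [← horth j k, L2.inner_def]
  refine integral_congr_ae ?_
  filter_upwards [(hφ j).coeFn_toLp, (hφ k).coeFn_toLp] with x h1 h2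
  simp [h1, h2, mul_comm]

/-- The residual path noise and the original randomization variable together act as the
randomization in the sequence model. -/
theorem exists_law_eq_map (hW : IsPreBrownianReal W P) (hWm : ∀ t, Measurable (W t))
    {ι : Type*} [Fintype ι] {φ : ι → ℝ → ℝ} (hφ : ∀ k, MemLp (φ k) 2 unitVol)
    (horth : Orthonormal ℝ fun k ↦ (hφ k).toLp) :
    ∃ T : (ι → ℝ) × (Ω × Z) → (unitInterval → ℝ) × Z, Measurable T ∧ ∀ θ : ι → ℝ,
      law n W P ν (comb φ θ) = (seqLaw (n : ℝ≥0)⁻¹ (P.prod ν) θ).map T := by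
  have := hW.isGaussianProcess.isProbabilityMeasure
  obtain ⟨S, hS, h⟩ := exists_map_path_eq (n := n) hW hWm hφ horth
  have hT : Measurable fun q : (ι → ℝ) × (Ω × Z) ↦ (S (q.1, q.2.1), q.2.2) := by fun_prop
  refine ⟨_, hT, fun θ ↦ ?_⟩
  change (P.map (path n W fun x ↦ ∑ k, θ k * φ k x)).prod ν = _
  rw [h, seqLaw, ← Measure.prodAssoc_prod, Measure.map_map hT (by fun_prop)]
  have h2 := Measure.map_prod_map ((Measure.pi fun k ↦ gaussianReal (θ k) (n : ℝ≥0)⁻¹).prod P) ν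
    hS measurable_id
  rw [Measure.map_id] at h2
  rw [h2]
  rfl

variable {β : ℕ} {R : ℝ}

/-- If the integrated squared bias is below `m^{-2β}` over the Sobolev ball, then the integrated
variance is at least `m / (4n)` somewhere on it. -/
theorem div_le_of_iVar_le (hW : IsPreBrownianReal W P) (hWm : ∀ t, Measurable (W t))
    (hn : 0 < n) (hR : 2 * Gam β < ENNReal.ofReal R) {fhat : (unitInterval → ℝ) × Z → ℝ → ℝ}
    (hm : Measurable (Function.uncurry fhat)) {B V : ℝ} (hB : 0 ≤ B) (hV : 0 ≤ V)
    (hbias : ∀ f ∈ sobolevBall β R, iBiasSq (law n W P ν f) fhat f ≤ ENNReal.ofReal B)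
    (hvar : ∀ f ∈ sobolevBall β R, iVar (law n W P ν f) fhat ≤ ENNReal.ofReal V)
    {m : ℕ} (hm0 : 0 < m) (hmB : B * ((m : ℝ) ^ β) ^ 2 < 1) : (m : ℝ) / (4 * n) ≤ V := by
  have := hW.isGaussianProcess.isProbabilityMeasure
  obtain ⟨φ, hφm, hφ, horth, hball⟩ := exists_orthonormal_system hR hm0
  obtain ⟨T, hT, hlaw⟩ := exists_law_eq_map (n := n) (ν := ν) hW hWm hφ (orthonormal_toLp hφ horth)
  have hv : (n : ℝ≥0)⁻¹ ≠ 0 := inv_ne_zero (by exact_mod_cast hn.ne')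
  have hmp : (0 : ℝ) < ((m : ℝ) ^ β) ^ 2 := by positivity
  have h := card_mul_le_of_iVar_le (ρ := P.prod ν) (V := V) (B := B)
    (b := 4 / ((m : ℝ) ^ β) ^ 2) (fhat := fun q ↦ fhat (T q)) hv hφm hφ horth
    (hm.comp ((hT.comp measurable_fst).prodMk measurable_snd)) hB
    (by rw [lt_div_iff₀ hmp]; linarith) hV
    (fun θ hθ ↦ by
      rw [← iBiasSq_map hT hm, ← hlaw]
      exact hbias _ (hball θ hθ))
    (fun θ hθ ↦ by
      rw [← iVar_map hT hm, ← hlaw]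
      exact hvar _ (hball θ hθ))
  refine le_trans (le_of_eq ?_) h
  rw [Fintype.card_fin]
  push_cast
  field_simp

theorem exists_nat_between {B : ℝ} (hB : 0 < B) (hB1 : B < 1) {β : ℕ} (hβ : 0 < β) :
    ∃ m : ℕ, 0 < m ∧ B * ((m : ℝ) ^ β) ^ 2 < 1 ∧ 1 ≤ 2 * B ^ (1 / (2 * β : ℝ)) * m := by
  have hβ0 : (0 : ℝ) < β := by exact_mod_cast hβ
  set s : ℝ := (B ^ (1 / (2 * β : ℝ)))⁻¹ with hs
  have hp : 0 < B ^ (1 / (2 * β : ℝ)) := Real.rpow_pos_of_pos hB _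
  have hs1 : 1 < s := (one_lt_inv₀ hp).2 (Real.rpow_lt_one hB.le hB1 (by positivity))
  have hsB : (s ^ β) ^ 2 = B⁻¹ := by
    rw [hs, ← pow_mul, inv_pow, ← Real.rpow_natCast, ← Real.rpow_mul hB.le]
    congr 1
    push_cast
    rw [one_div, mul_comm (β : ℝ) 2, inv_mul_cancel₀ (by positivity), Real.rpow_one]
  have hc : 1 < ⌈s⌉₊ := by
    rw [Nat.lt_ceil]
    exact_mod_cast hs1
  -- The largest integer strictly below s = B^{-1/(2β)}; strictness gives B m^{2β} < 1. As s > 1,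
  -- the ceiling is at least 2, so m is positive and s ≤ 2m.
  refine ⟨⌈s⌉₊ - 1, by omega, ?_, ?_⟩
  · have h1 : ((⌈s⌉₊ - 1 : ℕ) : ℝ) < s := Nat.lt_ceil.1 (by omega)
    have h2 : (((⌈s⌉₊ - 1 : ℕ) : ℝ) ^ β) ^ 2 < (s ^ β) ^ 2 := by
      gcongr
    rw [hsB] at h2
    calc _ < B * B⁻¹ := mul_lt_mul_of_pos_left h2 hB
      _ = 1 := mul_inv_cancel₀ hB.ne'
  · have h1 : s ≤ 2 * ((⌈s⌉₊ - 1 : ℕ) : ℝ) := by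
      rw [Nat.cast_sub hc.le]
      have h3 := Nat.le_ceil s
      have h4 : (2 : ℝ) ≤ ⌈s⌉₊ := by exact_mod_cast hc
      push_cast
      linarith
    have h2 := mul_le_mul_of_nonneg_left h1 hp.le
    rw [hs, mul_inv_cancel₀ hp.ne'] at h2
    linarith

/-- The product of the powers of worst-case bias and worst-case variance is bounded below. -/
theorem le_biasSq_rpow_mul_var (hW : IsPreBrownianReal W P) (hWm : ∀ t, Measurable (W t))
    (hn : 0 < n) (hβ : 0 < β) (hR : 2 * Gam β < ENNReal.ofReal R)
    {fhat : (unitInterval → ℝ) × Z → ℝ → ℝ} (hm : Measurable (Function.uncurry fhat))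
    {b v : ℝ≥0∞} (hb : b < 1) (hv : v ≠ ⊤)
    (hbias : ∀ f ∈ sobolevBall β R, iBiasSq (law n W P ν f) fhat f ≤ b)
    (hvar : ∀ f ∈ sobolevBall β R, iVar (law n W P ν f) fhat ≤ v) :
    1 / (8 * (n : ℝ≥0∞)) ≤ b ^ (1 / (2 * β : ℝ)) * v := by
  have hbt : b ≠ ⊤ := (hb.trans ENNReal.one_lt_top).ne
  obtain ⟨B, hB, rfl⟩ : ∃ B : ℝ, 0 ≤ B ∧ b = ENNReal.ofReal B :=
    ⟨b.toReal, ENNReal.toReal_nonneg, (ENNReal.ofReal_toReal hbt).symm⟩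
  obtain ⟨V, hV, rfl⟩ : ∃ V : ℝ, 0 ≤ V ∧ v = ENNReal.ofReal V :=
    ⟨v.toReal, ENNReal.toReal_nonneg, (ENNReal.ofReal_toReal hv).symm⟩
  have hB1 : B < 1 := by simpa using hb
  have hn0 : (0 : ℝ) < n := by exact_mod_cast hn
  have key {m : ℕ} (hm0 : 0 < m) (hmB : B * ((m : ℝ) ^ β) ^ 2 < 1) : (m : ℝ) / (4 * n) ≤ V :=
    div_le_of_iVar_le hW hWm hn hR hm hB hV hbias hvar hm0 hmB
  -- With zero bias every m is admissible, so no finite V is possible; this matches the convention 0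
  -- · ∞ = ∞.
  rcases hB.eq_or_lt with rfl | hBpos
  · exfalso
    obtain ⟨m, hmV⟩ := exists_nat_gt (V * (4 * n))
    have h1 := key (m := m + 1) (by omega) (by simp)
    rw [div_le_iff₀ (by positivity)] at h1
    push_cast at h1
    linarith
  obtain ⟨m, hm0, hmB, hmle⟩ := exists_nat_between hBpos hB1 hβ
  have h1 := key hm0 hmB
  rw [div_le_iff₀ (by positivity)] at h1
  have hp : 0 < B ^ (1 / (2 * β : ℝ)) := Real.rpow_pos_of_pos hBpos _
  have h2 : 1 / (8 * (n : ℝ)) ≤ B ^ (1 / (2 * β : ℝ)) * V := by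
    rw [div_le_iff₀ (by positivity)]
    nlinarith [mul_le_mul_of_nonneg_left h1 hp.le]
  rw [ENNReal.ofReal_rpow_of_pos hBpos, ← ENNReal.ofReal_mul hp.le]
  refine le_trans (le_of_eq ?_) (ENNReal.ofReal_le_ofReal h2)
  rw [ENNReal.ofReal_div_of_pos (by positivity), ENNReal.ofReal_mul (by norm_num)]
  simp

end Model

end WhiteNoise

theorem theorem5p1 {Ω Z : Type*} [MeasurableSpace Ω] [MeasurableSpace Z]
    (P : Measure Ω) [IsProbabilityMeasure P]
    (W : ℝ≥0 → Ω → ℝ) (hWm : ∀ t, Measurable (W t)) (hW : IsBrownianReal W P)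
    (ν : Measure Z) [IsProbabilityMeasure ν]
    (n : ℕ) (hn : 0 < n) (β : ℕ) (hβ : 0 < β) (R : ℝ)
    (hR : 2 * WhiteNoise.Gam β < ENNReal.ofReal R) :
    1 / (8 * (n : ℝ≥0∞)) ≤
      (⨅ fhat ∈ WhiteNoise.smallBias β (WhiteNoise.sobolevBall β R) (WhiteNoise.law n W P ν),
        WhiteNoise.mulTop
          (⨆ f ∈ WhiteNoise.sobolevBall β R,
            WhiteNoise.iBias (WhiteNoise.law n W P ν f) fhat f ^ (1 / (β : ℝ)))
          (⨆ f ∈ WhiteNoise.sobolevBall β R,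
            WhiteNoise.iVar (WhiteNoise.law n W P ν f) fhat)) ∧
    min ((1 / (8 * (n : ℝ≥0∞))) ^ (2 * (β : ℝ) / (2 * (β : ℝ) + 1))) 1 ≤
      ⨅ (fhat : (unitInterval → ℝ) × Z → ℝ → ℝ) (_ : Measurable (Function.uncurry fhat)),
        ⨆ f ∈ WhiteNoise.sobolevBall β R,
          WhiteNoise.mise (WhiteNoise.law n W P ν f) fhat f := by
  have hβ0 : (0 : ℝ) < β := by exact_mod_cast hβ
  constructor
  · refine le_iInf₂ fun fhat hf ↦ ?_
    obtain ⟨⟨hm, -⟩, hsmall⟩ := hf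
    rw [WhiteNoise.mulTop]
    split_ifs with htop
    · exact le_top
    push Not at htop
    set b : ℝ≥0∞ := ⨆ f ∈ WhiteNoise.sobolevBall β R,
      WhiteNoise.iBiasSq (WhiteNoise.law n W P ν f) fhat f with hb
    -- The threshold 2^{-β} enters only through b < 1, which ensures that m = 1 is already
    -- admissible.
    have hb1 : b < 1 := hsmall.trans_le (pow_le_one₀ zero_le (by simp))
    refine (WhiteNoise.le_biasSq_rpow_mul_var hW.toIsPreBrownianReal hWm hn hβ hR hm hb1 htop.2
      (fun f hf ↦ le_iSup₂ (f := fun f _ ↦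
        WhiteNoise.iBiasSq (WhiteNoise.law n W P ν f) fhat f) f hf)
      (fun f hf ↦ le_iSup₂ (f := fun f _ ↦
        WhiteNoise.iVar (WhiteNoise.law n W P ν f) fhat) f hf)).trans ?_
    gcongr
    -- Moving the exponent 1/(2β) to the other side allows the supremum of squared biases to be
    -- bounded term by term.
    rw [one_div, ENNReal.rpow_inv_le_iff (by positivity), hb]
    refine iSup₂_le fun f hf ↦ ?_
    have h1 := le_iSup₂ (f := fun f (_ : f ∈ WhiteNoise.sobolevBall β R) ↦
      WhiteNoise.iBias (WhiteNoise.law n W P ν f) fhat f ^ (1 / (β : ℝ))) f hf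
    refine le_trans (le_of_eq ?_) (ENNReal.rpow_le_rpow h1 (by positivity))
    rw [WhiteNoise.iBias, ← ENNReal.rpow_mul, ← ENNReal.rpow_mul]
    have : 1 / 2 * (1 / (β : ℝ)) * (2 * β) = 1 := by field_simp
    rw [← mul_assoc, this, ENNReal.rpow_one]
  · refine le_iInf₂ fun fhat hm ↦ ?_
    by_contra! hlt
    set M : ℝ≥0∞ := ⨆ f ∈ WhiteNoise.sobolevBall β R,
      WhiteNoise.mise (WhiteNoise.law n W P ν f) fhat f with hM
    obtain ⟨h1, h2⟩ := lt_min_iff.1 hlt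
    have hle (f : ℝ → ℝ) (hf : f ∈ WhiteNoise.sobolevBall β R) :
        WhiteNoise.iBiasSq (WhiteNoise.law n W P ν f) fhat f ≤ M ∧
          WhiteNoise.iVar (WhiteNoise.law n W P ν f) fhat ≤ M := by
      have := WhiteNoise.isProbabilityMeasure_law (n := n) (ν := ν) (P := P) hWm f
      have h3 := WhiteNoise.iBiasSq_le_mise_and_iVar_le_mise (Q := WhiteNoise.law n W P ν f) hm
        (WhiteNoise.aemeasurable_of_mem_sobolevBall hf)
      have h4 : WhiteNoise.mise (WhiteNoise.law n W P ν f) fhat f ≤ M :=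
        le_iSup₂ (f := fun f (_ : f ∈ WhiteNoise.sobolevBall β R) ↦
          WhiteNoise.mise (WhiteNoise.law n W P ν f) fhat f) f hf
      exact ⟨h3.1.trans h4, h3.2.trans h4⟩
    have hMt : M ≠ ⊤ := (h2.trans ENNReal.one_lt_top).ne
    have h5 := WhiteNoise.le_biasSq_rpow_mul_var hW.toIsPreBrownianReal hWm hn hβ hR hm h2 hMt
      (fun f hf ↦ (hle f hf).1) (fun f hf ↦ (hle f hf).2)
    -- The exponents add to 1/(2β) + 1 = (2β + 1)/(2β), the inverse of the exponent in the rate.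
    have e1 : M ^ (1 / (2 * β : ℝ)) * M = M ^ ((2 * β / (2 * β + 1) : ℝ)⁻¹) := by
      conv_lhs => rw [← ENNReal.rpow_one M, ← ENNReal.rpow_mul, one_mul,
        ← ENNReal.rpow_add_of_nonneg _ _ (by positivity) zero_le_one]
      congr 1
      field_simp
      ring
    rw [e1, ENNReal.le_rpow_inv_iff (by positivity)] at h5
    exact absurd h5 (not_le.2 h1)
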